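/- Let $E$ be a real Banach lattice which is either order continuous (every downward directed set in $E$ with infimum $0$ converges to $0$ in norm) or a Köthe function space, i.e. (up to lattice isometry) a Banach space of a.e.-equivalence classes of real measurable functions on a complete $\sigma$-finite measure space $(\Omega,\Sigma,\mu)$, integrable on sets of finite measure, such that $|f|\le|g|$ a.e., $f$ measurable and $g\in E$ imply $f\in E$ and $\|f\|\le\|g\|$, and such that $\chi_A\in E$ whenever $\mu(A)<\infty$. Expressions such as $(|x|^p+|y|^p)^{1/p}$ are formed in $E$ by the Krivine functional calculus. Write $S_X$ for the unit sphere of $X$. For $p\ge 1$ let $E^{(p)}$ be the $p$-convexification of $E$: the set $E$ with $x\oplus y=(x^{1/p}+y^{1/p})^p$ and $a\odot x=a^p x$ (powers taken sign-preservingly, $s^r=\operatorname{sign}(s)|s|^r$) and the norm $\|x\|_{E^{(p)}}=\|x\|_E^{1/p}$. Let $E^{\mathbb C}=E\oplus iE$ be the complexification of $E$ with the norm $\|x+iy\|=\|(|x|^2+|y|^2)^{1/2}\|_E$. Then the following are equivalent. 1. $E$ is upper locally uniformly monotone: for some $1\le p<\infty$, for all $x\in S_E$ and $\epsilon>0$,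 $\inf\{\|(|x|^p+|y|^p)^{1/p}\|-1:\ y\in E,\ \|y\|\ge\epsilon\}>0$. 2. $E^{\mathbb C}$ is locally uniformly complex convex: for every $x\in S_{E^{\mathbb C}}$ there is $0<p<\infty$ such that for all $\epsilon>0$, $\inf\{(\frac1{2\pi}\int_0^{2\pi}\|x+e^{i\theta}y\|^p\,d\theta)^{1/p}-1:\ y\in E^{\mathbb C},\ \|y\|\ge\epsilon\}>0$. 3. For all $1<p<\infty$, $E^{(p)}$ is midpoint locally uniformly convex: for every $x\in S_{E^{(p)}}$ and $\epsilon>0$ there is $\delta>0$ with $\max\{\|x\oplus y\|,\|x\ominus y\|\}\ge 1+\delta$ for all $y\in E^{(p)}$ with $\|y\|\ge\epsilon$ (norms in $E^{(p)}$). 4. For some $1<p<\infty$, $E^{(p)}$ is midpoint locally uniformly convex. -/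

import Mathlib

noncomputable section
set_option linter.unusedSectionVars false
set_option linter.unusedSimpArgs false

/-- Continuous positively homogeneous (of degree one) functions `ℝ^ι → ℝ`. -/
def PosHom (ι : Type*) : Submodule ℝ ((ι → ℝ) → ℝ) where
  carrier := {h | Continuous h ∧ ∀ c : ℝ, 0 ≤ c → ∀ t, h (c • t) = c * h t}
  add_mem' := by
    rintro f g ⟨hf, hf'⟩ ⟨hg, hg'⟩
    exact ⟨hf.add hg, fun c hc t => by simp [hf' c hc, hg' c hc, mul_add]⟩
  zero_mem' := ⟨continuous_const, fun c _ t => by simp⟩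
  smul_mem' := by
    rintro a f ⟨hf, hf'⟩
    exact ⟨hf.const_smul a, fun c hc t => by simp [hf' c hc]; ring⟩

namespace PosHom

variable {ι : Type*}

instance : Lattice (PosHom ι) :=
  Subtype.lattice
    (by
      rintro f g ⟨hf, hf'⟩ ⟨hg, hg'⟩
      exact ⟨hf.sup hg, fun c hc t => by simp [hf' c hc, hg' c hc, mul_max_of_nonneg _ _ hc]⟩)
    (by
      rintro f g ⟨hf, hf'⟩ ⟨hg, hg'⟩
      exact ⟨hf.inf hg, fun c hc t => by simp [hf' c hc, hg' c hc, mul_min_of_nonneg _ _ hc]⟩)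

/-- The coordinate functions. -/
def proj (i : ι) : PosHom ι := ⟨fun t => t i, continuous_apply i, fun c _ t => by simp⟩

/-- Composition of positively homogeneous functions. -/
def comp {κ : Type*} (h : PosHom κ) (g : κ → PosHom ι) : PosHom ι :=
  ⟨fun t => h.1 fun j => (g j).1 t,
    h.2.1.comp (continuous_pi fun j => (g j).2.1), fun c hc t => by
      rw [← h.2.2 c hc]
      exact congrArg h.1 (funext fun j => (g j).2.2 c hc t)⟩

end PosHom

section Krivine

variable {ι : Type*} [Fintype ι] {E : Type*} [NormedAddCommGroup E] [NormedSpace ℝ E] [Lattice E]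
  [HasSolidNorm E] [IsOrderedAddMonoid E] [IsOrderedModule ℝ E]

/-- Lattice expressions in linear forms, paired with their values at `x` in `E`. -/
def latticeTerms (x : ι → E) : Set (((ι → ℝ) → ℝ) × E) :=
  latticeClosure (Set.range fun a : ι → ℝ => (fun t => ∑ i, a i * t i, ∑ i, a i • x i))

theorem latticeTerms_sup {x : ι → E} {p q} (hp : p ∈ latticeTerms x) (hq : q ∈ latticeTerms x) :
    p ⊔ q ∈ latticeTerms x := isSublattice_latticeClosure.1 hp hq

theorem latticeTerms_inf {x : ι → E} {p q} (hp : p ∈ latticeTerms x) (hq : q ∈ latticeTerms x) :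
    p ⊓ q ∈ latticeTerms x := isSublattice_latticeClosure.2 hp hq

theorem latticeTerms_lin (x : ι → E) (a : ι → ℝ) :
    ((fun t => ∑ i, a i * t i, ∑ i, a i • x i) : ((ι → ℝ) → ℝ) × E) ∈ latticeTerms x :=
  subset_latticeClosure ⟨a, rfl⟩

theorem latticeTerms_add {x : ι → E} {p q} (hp : p ∈ latticeTerms x) (hq : q ∈ latticeTerms x) :
    p + q ∈ latticeTerms x := by
  have key : ∀ a : ι → ℝ, latticeTerms x ⊆
      {q | ((fun t => ∑ i, a i * t i, ∑ i, a i • x i) : ((ι → ℝ) → ℝ) × E) + q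
        ∈ latticeTerms x} := by
    intro a
    refine latticeClosure_min ?_ ⟨?_, ?_⟩
    · rintro _ ⟨b, rfl⟩
      show _ ∈ latticeTerms x
      convert latticeTerms_lin x (a + b) using 1
      ext
      · simp [add_mul, Finset.sum_add_distrib]
      · simp [add_smul, Finset.sum_add_distrib]
    · intro u hu v hv
      simp only [Set.mem_ofPred_eq] at *
      rw [add_sup]; exact latticeTerms_sup hu hv
    · intro u hu v hv
      simp only [Set.mem_ofPred_eq] at *
      rw [add_inf]; exact latticeTerms_inf hu hv
  have : latticeTerms x ⊆ {p | p + q ∈ latticeTerms x} := by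
    refine latticeClosure_min ?_ ⟨?_, ?_⟩
    · rintro _ ⟨b, rfl⟩
      exact key b hq
    · intro u hu v hv
      simp only [Set.mem_ofPred_eq] at *
      rw [sup_add]; exact latticeTerms_sup hu hv
    · intro u hu v hv
      simp only [Set.mem_ofPred_eq] at *
      rw [inf_add]; exact latticeTerms_inf hu hv
  exact this hp

theorem latticeTerms_neg {x : ι → E} {p} (hp : p ∈ latticeTerms x) : -p ∈ latticeTerms x := by
  have : latticeTerms x ⊆ {p | -p ∈ latticeTerms x} := by
    refine latticeClosure_min ?_ ⟨?_, ?_⟩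
    · rintro _ ⟨b, rfl⟩
      show _ ∈ latticeTerms x
      convert latticeTerms_lin x (-b) using 1
      ext <;> simp
    · intro u hu v hv
      simp only [Set.mem_ofPred_eq] at *
      rw [neg_sup]; exact latticeTerms_inf hu hv
    · intro u hu v hv
      simp only [Set.mem_ofPred_eq] at *
      rw [neg_inf]; exact latticeTerms_sup hu hv
  exact this hp

theorem smul_sup_of_nonneg {F : Type*} [AddCommGroup F] [Lattice F] [IsOrderedAddMonoid F]
    [Module ℝ F] [IsOrderedModule ℝ F] {c : ℝ} (hc : 0 ≤ c) (u v : F) :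
    c • (u ⊔ v) = c • u ⊔ c • v := by
  rcases hc.eq_or_lt with rfl | hc
  · simp
  · exact (OrderIso.smulRight hc).map_sup u v

theorem smul_inf_of_nonneg {F : Type*} [AddCommGroup F] [Lattice F] [IsOrderedAddMonoid F]
    [Module ℝ F] [IsOrderedModule ℝ F] {c : ℝ} (hc : 0 ≤ c) (u v : F) :
    c • (u ⊓ v) = c • u ⊓ c • v := by
  rcases hc.eq_or_lt with rfl | hc
  · simp
  · exact (OrderIso.smulRight hc).map_inf u v

theorem latticeTerms_smul {x : ι → E} (c : ℝ) {p} (hp : p ∈ latticeTerms x) :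
    c • p ∈ latticeTerms x := by
  have key : ∀ c : ℝ, 0 ≤ c → latticeTerms x ⊆ {p | c • p ∈ latticeTerms x} := by
    intro c hc
    refine latticeClosure_min ?_ ⟨?_, ?_⟩
    · rintro _ ⟨b, rfl⟩
      show _ ∈ latticeTerms x
      convert latticeTerms_lin x (c • b) using 1
      ext
      · simp [Finset.mul_sum, mul_assoc]
      · simp [Finset.smul_sum, mul_smul]
    · intro u hu v hv
      simp only [Set.mem_ofPred_eq] at *
      have : c • (u ⊔ v) = c • u ⊔ c • v := Prod.ext
        (funext fun t => mul_max_of_nonneg _ _ hc) (smul_sup_of_nonneg hc _ _)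
      rw [this]; exact latticeTerms_sup hu hv
    · intro u hu v hv
      simp only [Set.mem_ofPred_eq] at *
      have : c • (u ⊓ v) = c • u ⊓ c • v := Prod.ext
        (funext fun t => mul_min_of_nonneg _ _ hc) (smul_inf_of_nonneg hc _ _)
      rw [this]; exact latticeTerms_inf hu hv
  rcases le_total 0 c with hc | hc
  · exact key c hc hp
  · have := latticeTerms_neg (key (-c) (by linarith) hp)
    simpa using this

theorem latticeTerms_sum_abs (x : ι → E) :
    ((fun t => ∑ i, |t i|, ∑ i, |x i|) : ((ι → ℝ) → ℝ) × E) ∈ latticeTerms x := by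
  classical
  have key : ∀ s : Finset ι, ((fun t => ∑ i ∈ s, |t i|, ∑ i ∈ s, |x i|) : ((ι → ℝ) → ℝ) × E)
      ∈ latticeTerms x := by
    intro s
    induction s using Finset.induction_on with
    | empty => simpa using latticeTerms_lin x 0
    | insert i s hi ih =>
      have h1 := latticeTerms_lin x (Pi.single i 1)
      have h2 := latticeTerms_add (latticeTerms_sup h1 (latticeTerms_neg h1)) ih
      convert h2 using 1
      ext
      · simp [Finset.sum_insert hi, Pi.single_apply, abs]
      · simp [Finset.sum_insert hi, Pi.single_apply, abs, ite_smul]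
  exact key Finset.univ

theorem latticeTerms_posHom {x : ι → E} {p} (hp : p ∈ latticeTerms x) : p.1 ∈ PosHom ι := by
  have : latticeTerms x ⊆ {p | p.1 ∈ PosHom ι} := by
    refine latticeClosure_min ?_ ⟨?_, ?_⟩
    · rintro _ ⟨b, rfl⟩
      refine ⟨by fun_prop, fun c _ t => ?_⟩
      simp only [Pi.smul_apply, smul_eq_mul, Finset.mul_sum]
      exact Finset.sum_congr rfl fun i _ => by ring
    · intro u hu v hv
      exact ((⟨_, hu⟩ : PosHom ι) ⊔ ⟨_, hv⟩).2
    · intro u hu v hv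
      exact ((⟨_, hu⟩ : PosHom ι) ⊓ ⟨_, hv⟩).2
  exact this hp

/-- Finitely many linear forms whose maximum is nonnegative have `0` in their convex hull. -/
theorem zero_mem_convexHull_of_forms (s : Finset (ι → ℝ))
    (h : ∀ t : ι → ℝ, ∃ a ∈ s, 0 ≤ ∑ i, a i * t i) : (0 : ι → ℝ) ∈ convexHull ℝ (s : Set (ι → ℝ)) := by
  classical
  by_contra hn
  obtain ⟨f, u, hu, hf⟩ := geometric_hahn_banach_point_closed (convex_convexHull ℝ _)
    (s.finite_toSet.isClosed_convexHull (𝕜 := ℝ)) hn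
  obtain ⟨a, ha, h0⟩ := h fun i => - f (Pi.single i 1)
  have h1 := hf a (subset_convexHull ℝ _ ha)
  have h2 : f a = ∑ i, a i * f (Pi.single i 1) := by
    conv_lhs => rw [pi_eq_sum_univ' a]
    simp [map_sum]
  simp only [mul_neg, Finset.sum_neg_distrib] at h0
  simp at hu
  linarith

theorem latticeTerms_nonneg {x : ι → E} {p} (hp : p ∈ latticeTerms x) (h0 : 0 ≤ p.1) :
    0 ≤ p.2 := by
  classical
  let : DistribLattice E := AddCommGroup.toDistribLattice E
  have e : latticeTerms x = infClosure (supClosure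
      (Set.range fun a : ι → ℝ => (fun t => ∑ i, a i * t i, ∑ i, a i • x i))) :=
    (infClosure_supClosure _).symm
  have h1 : supClosure
      (Set.range fun a : ι → ℝ => ((fun t => ∑ i, a i * t i, ∑ i, a i • x i) : ((ι → ℝ) → ℝ) × E)) ⊆
      {q | ∃ s : Finset (ι → ℝ), (∀ t, ∃ a ∈ s, q.1 t ≤ ∑ i, a i * t i) ∧
        ∀ a ∈ s, ∑ i, a i • x i ≤ q.2} := by
    refine supClosure_min ?_ ?_
    · rintro _ ⟨b, rfl⟩
      exact ⟨{b}, fun t => ⟨b, by simp⟩, by simp⟩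
    · rintro u ⟨s, hs, hs'⟩ v ⟨r, hr, hr'⟩
      refine ⟨s ∪ r, fun t => ?_, fun a ha => ?_⟩
      · rcases le_total (u.1 t) (v.1 t) with h | h
        · obtain ⟨a, ha, h2⟩ := hr t
          exact ⟨a, by simp [ha], by simpa [h] using h2⟩
        · obtain ⟨a, ha, h2⟩ := hs t
          exact ⟨a, by simp [ha], by simpa [h] using h2⟩
      · rcases Finset.mem_union.1 ha with ha | ha
        · exact (hs' a ha).trans le_sup_left
        · exact (hr' a ha).trans le_sup_right
  have h2 : latticeTerms x ⊆ {q | 0 ≤ q.1 → 0 ≤ q.2} := by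
    rw [e]
    refine infClosure_min ?_ ?_
    · intro q hq hq0
      obtain ⟨s, hs, hs'⟩ := h1 hq
      have := zero_mem_convexHull_of_forms s fun t => by
        obtain ⟨a, ha, h⟩ := hs t
        exact ⟨a, ha, (hq0 t).trans h⟩
      obtain ⟨w, hw, hw1, hw0⟩ := Finset.mem_convexHull'.1 this
      calc (0 : E) = ∑ a ∈ s, w a • ∑ i, a i • x i := by
            simp_rw [Finset.smul_sum, smul_smul]
            rw [Finset.sum_comm]
            simp_rw [← Finset.sum_smul]
            refine (Finset.sum_eq_zero fun i _ => ?_).symm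
            have := congrFun hw0 i
            simp at this
            rw [this, zero_smul]
        _ ≤ ∑ a ∈ s, w a • q.2 := Finset.sum_le_sum fun a ha =>
            smul_le_smul_of_nonneg_left (hs' a ha) (hw a ha)
        _ = q.2 := by rw [← Finset.sum_smul, hw1, one_smul]
    · intro u hu v hv h
      exact le_inf (hu (h.trans inf_le_left)) (hv (h.trans inf_le_right))
  exact h2 hp h0

theorem latticeTerms_dense (x : ι → E) (h : PosHom ι) {ε : ℝ} (hε : 0 < ε) :
    ∃ p ∈ latticeTerms x, ∀ t, |h.1 t - p.1 t| ≤ ε * ∑ i, |t i| := by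
  classical
  let K : Set (ι → ℝ) := {t | ∑ i, |t i| = 1}
  have hK : IsCompact K := by
    refine Metric.isCompact_of_isClosed_isBounded
      (isClosed_eq (by fun_prop) continuous_const) ?_
    refine (Metric.isBounded_closedBall (x := (0 : ι → ℝ)) (r := 1)).subset fun t ht => ?_
    rw [mem_closedBall_zero_iff, pi_norm_le_iff_of_nonneg zero_le_one]
    intro i
    rw [← (ht : ∑ i, |t i| = 1), Real.norm_eq_abs]
    exact Finset.single_le_sum (f := fun i => |t i|) (fun i _ => abs_nonneg _) (Finset.mem_univ i)
  have : CompactSpace K := isCompact_iff_compactSpace.1 hK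
  let L : Set C(K, ℝ) := {f | ∃ p ∈ latticeTerms x, ∀ t : K, f t = p.1 t}
  have mem : ∀ p ∈ latticeTerms x, ∃ f ∈ L, ∀ t : K, f t = p.1 t := fun p hp =>
    ⟨⟨fun t => p.1 t, (latticeTerms_posHom hp).1.comp continuous_subtype_val⟩,
      ⟨p, hp, fun _ => rfl⟩, fun _ => rfl⟩
  have hL : closure L = ⊤ := by
    refine ContinuousMap.sublattice_closure_eq_top L ?_ ?_ ?_ ?_
    · obtain ⟨f, hf, -⟩ := mem _ (latticeTerms_lin x 0)
      exact ⟨f, hf⟩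
    · rintro f ⟨p, hp, hf⟩ g ⟨q, hq, hg⟩
      exact ⟨_, latticeTerms_inf hp hq, fun t => by simp [hf, hg]⟩
    · rintro f ⟨p, hp, hf⟩ g ⟨q, hq, hg⟩
      exact ⟨_, latticeTerms_sup hp hq, fun t => by simp [hf, hg]⟩
    · intro v y z
      by_cases hyz : y = z
      · subst hyz
        obtain ⟨f, hf, hf'⟩ := mem _ (latticeTerms_smul (v y) (latticeTerms_sum_abs x))
        have : f y = v y := by
          have hy : ∑ i, |y.1 i| = 1 := y.2
          rw [hf']; simp [hy]
        exact ⟨f, hf, this, this⟩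
      · obtain ⟨i, hi⟩ : ∃ i, y.1 i ≠ z.1 i := by
          by_contra! hcon
          exact hyz (Subtype.ext (funext hcon))
        have hd : y.1 i - z.1 i ≠ 0 := sub_ne_zero.2 hi
        obtain ⟨f, hf, hf'⟩ := mem _ (latticeTerms_add
          (latticeTerms_smul (v y - (v y - v z) / (y.1 i - z.1 i) * y.1 i) (latticeTerms_sum_abs x))
          (latticeTerms_smul ((v y - v z) / (y.1 i - z.1 i)) (latticeTerms_lin x (Pi.single i 1))))
        have hy : ∑ i, |y.1 i| = 1 := y.2
        have hz : ∑ i, |z.1 i| = 1 := z.2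
        refine ⟨f, hf, ?_, ?_⟩
        · rw [hf']; simp [hy, Pi.single_apply]
        · rw [hf']; simp [hz, Pi.single_apply]; field_simp; ring
  let f0 : C(K, ℝ) := ⟨fun t => h.1 t, h.2.1.comp continuous_subtype_val⟩
  have hf0 : f0 ∈ closure L := by rw [hL]; trivial
  obtain ⟨f, ⟨p, hp, hfp⟩, hd⟩ := Metric.mem_closure_iff.1 hf0 ε hε
  refine ⟨p, hp, fun t => ?_⟩
  set S := ∑ i, |t i| with hS
  have hS0 : 0 ≤ S := Finset.sum_nonneg fun i _ => abs_nonneg _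
  rcases hS0.eq_or_lt with h0 | hpos
  · have ht : t = (0 : ℝ) • t := by
      funext i
      have := (Finset.sum_eq_zero_iff_of_nonneg (fun i _ => abs_nonneg (t i))).1 (hS.symm.trans h0.symm)
        i (Finset.mem_univ i)
      simpa using this
    rw [ht, h.2.2 0 le_rfl, (latticeTerms_posHom hp).2 0 le_rfl, ← h0]
    simp
  · let y : K := ⟨S⁻¹ • t, by
      simp only [K, Set.mem_ofPred_eq, Pi.smul_apply, smul_eq_mul, abs_mul, ← Finset.mul_sum,
        abs_of_pos (inv_pos.2 hpos)]
      exact inv_mul_cancel₀ hpos.ne'⟩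
    have h1 : |h.1 y.1 - p.1 y.1| ≤ ε := by
      have := (ContinuousMap.dist_apply_le_dist (f := f0) (g := f) y).trans hd.le
      rwa [hfp, Real.dist_eq] at this
    have ht : t = S • y.1 := by simp [y, smul_smul, hpos.ne']
    rw [ht, h.2.2 S hS0, (latticeTerms_posHom hp).2 S hS0, ← mul_sub, abs_mul, abs_of_pos hpos]
    nlinarith


/-- `z` is a limit of values at `x` of lattice expressions approximating `h`. -/
def KrivineRel (x : ι → E) (h : PosHom ι) (z : E) : Prop :=
  ∀ ε : ℝ, 0 < ε → ∃ p ∈ latticeTerms x,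
    (∀ t, |h.1 t - p.1 t| ≤ ε * ∑ i, |t i|) ∧ ‖z - p.2‖ ≤ ε

theorem KrivineRel.of_term {x : ι → E} {h : PosHom ι} {p} (hp : p ∈ latticeTerms x)
    (hh : p.1 = h.1) : KrivineRel x h p.2 := fun ε hε =>
  ⟨p, hp, fun t => by
    simpa [hh] using mul_nonneg hε.le (Finset.sum_nonneg fun i _ => abs_nonneg (t i)), by simpa using hε.le⟩

theorem KrivineRel.add {x : ι → E} {h k : PosHom ι} {z w : E} (h1 : KrivineRel x h z)
    (h2 : KrivineRel x k w) : KrivineRel x (h + k) (z + w) := fun ε hε => by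
  obtain ⟨p, hp, hp1, hp2⟩ := h1 (ε / 2) (half_pos hε)
  obtain ⟨q, hq, hq1, hq2⟩ := h2 (ε / 2) (half_pos hε)
  refine ⟨_, latticeTerms_add hp hq, fun t => ?_, ?_⟩
  · calc |(h + k).1 t - (p + q).1 t| = |(h.1 t - p.1 t) + (k.1 t - q.1 t)| := by
          congr 1; simp; ring
      _ ≤ ε / 2 * ∑ i, |t i| + ε / 2 * ∑ i, |t i| :=
          (abs_add_le _ _).trans (add_le_add (hp1 t) (hq1 t))
      _ = _ := by ring
  · calc ‖z + w - (p + q).2‖ = ‖(z - p.2) + (w - q.2)‖ := by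
          congr 1; simp; abel
      _ ≤ ε / 2 + ε / 2 := (norm_add_le _ _).trans (add_le_add hp2 hq2)
      _ = _ := by ring

theorem KrivineRel.sup {x : ι → E} {h k : PosHom ι} {z w : E} (h1 : KrivineRel x h z)
    (h2 : KrivineRel x k w) : KrivineRel x (h ⊔ k) (z ⊔ w) := fun ε hε => by
  obtain ⟨p, hp, hp1, hp2⟩ := h1 (ε / 2) (half_pos hε)
  obtain ⟨q, hq, hq1, hq2⟩ := h2 (ε / 2) (half_pos hε)
  have hS : ∀ t : ι → ℝ, 0 ≤ ∑ i, |t i| := fun t => Finset.sum_nonneg fun i _ => abs_nonneg _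
  refine ⟨_, latticeTerms_sup hp hq, fun t => ?_, ?_⟩
  · calc |(h ⊔ k).1 t - (p ⊔ q).1 t| = |max (h.1 t) (k.1 t) - max (p.1 t) (q.1 t)| := rfl
      _ ≤ max |h.1 t - p.1 t| |k.1 t - q.1 t| := abs_max_sub_max_le_max _ _ _ _
      _ ≤ _ := max_le ((hp1 t).trans (by nlinarith [hS t])) ((hq1 t).trans (by nlinarith [hS t]))
  · calc ‖z ⊔ w - (p ⊔ q).2‖ ≤ ‖z - p.2‖ + ‖w - q.2‖ := norm_sup_sub_sup_le_add_norm _ _ _ _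
      _ ≤ ε / 2 + ε / 2 := add_le_add hp2 hq2
      _ = _ := by ring

theorem KrivineRel.smul {x : ι → E} {h : PosHom ι} {z : E} (c : ℝ) (h1 : KrivineRel x h z) :
    KrivineRel x (c • h) (c • z) := fun ε hε => by
  have hc : 0 < |c| + 1 := by positivity
  obtain ⟨p, hp, hp1, hp2⟩ := h1 (ε / (|c| + 1)) (by positivity)
  have hS : ∀ t : ι → ℝ, 0 ≤ ∑ i, |t i| := fun t => Finset.sum_nonneg fun i _ => abs_nonneg _
  have hle : |c| * (ε / (|c| + 1)) ≤ ε := by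
    rw [← mul_div_assoc, div_le_iff₀ hc]; nlinarith
  refine ⟨_, latticeTerms_smul c hp, fun t => ?_, ?_⟩
  · calc |(c • h).1 t - (c • p).1 t| = |c| * |h.1 t - p.1 t| := by
          rw [← abs_mul, mul_sub]; rfl
      _ ≤ |c| * (ε / (|c| + 1) * ∑ i, |t i|) := by gcongr; exact hp1 t
      _ = |c| * (ε / (|c| + 1)) * ∑ i, |t i| := by ring
      _ ≤ _ := by gcongr
  · calc ‖c • z - (c • p).2‖ = |c| * ‖z - p.2‖ := by
          rw [← Real.norm_eq_abs, ← norm_smul, smul_sub]; rfl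
      _ ≤ |c| * (ε / (|c| + 1)) := by gcongr
      _ ≤ _ := hle

theorem KrivineRel.nonneg {x : ι → E} {h : PosHom ι} {z : E} (h1 : KrivineRel x h z)
    (h0 : ∀ t, 0 ≤ h.1 t) : 0 ≤ z := by
  set u : E := ∑ i, |x i| with hu
  have hcl : IsClosed {z : E | 0 ≤ z} := isClosed_Ici
  refine hcl.closure_subset (Metric.mem_closure_iff.2 fun ε hε => ?_)
  set δ := ε / (2 * (1 + ‖u‖)) with hδ
  have hn : 0 < 1 + ‖u‖ := by positivity
  have hδ0 : 0 < δ := by positivity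
  obtain ⟨p, hp, hp1, hp2⟩ := h1 δ hδ0
  refine ⟨p.2 + δ • u, ?_, ?_⟩
  · refine latticeTerms_nonneg (latticeTerms_add hp
      (latticeTerms_smul δ (latticeTerms_sum_abs x))) fun t => ?_
    have := (abs_le.1 (hp1 t)).2
    have h2 := h0 t
    show 0 ≤ p.1 t + δ * ∑ i, |t i|
    linarith
  · have : δ * (1 + ‖u‖) = ε / 2 := by rw [hδ]; field_simp
    calc dist z (p.2 + δ • u) = ‖(z - p.2) - δ • u‖ := by rw [dist_eq_norm, sub_sub]
      _ ≤ ‖z - p.2‖ + ‖δ • u‖ := norm_sub_le _ _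
      _ ≤ δ + δ * ‖u‖ := by
          rw [norm_smul, Real.norm_of_nonneg hδ0.le]; gcongr
      _ < ε := by linarith

theorem KrivineRel.unique {x : ι → E} {h : PosHom ι} {z w : E} (h1 : KrivineRel x h z)
    (h2 : KrivineRel x h w) : z = w := by
  have key : ∀ {z w : E}, KrivineRel x h z → KrivineRel x h w → w ≤ z := by
    intro z w h1 h2
    have := (h1.add (h2.smul (-1))).nonneg (fun t => by simp)
    simpa [← sub_eq_add_neg] using this
  exact le_antisymm (key h2 h1) (key h1 h2)

theorem KrivineRel.exists [CompleteSpace E] (x : ι → E) (h : PosHom ι) :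
    ∃ z, KrivineRel x h z := by
  set u : E := ∑ i, |x i| with hu
  have hpos : ∀ n : ℕ, (0 : ℝ) < (1 / 2) ^ n := fun n => by positivity
  choose p hp hp1 using fun n : ℕ => latticeTerms_dense x h (hpos n)
  have hu0 : 0 ≤ u := Finset.sum_nonneg fun i _ => abs_nonneg _
  have hb : ∀ n m, n ≤ m → ‖(p n).2 - (p m).2‖ ≤ 2 * (1 / 2) ^ n * ‖u‖ := by
    intro n m hnm
    have key : ∀ n m (c : ℝ), (1 / 2) ^ n + (1 / 2) ^ m ≤ c →
        (p n).2 - (p m).2 ≤ c • u := by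
      intro n m c hc
      have := latticeTerms_nonneg (latticeTerms_add (latticeTerms_smul c
        (latticeTerms_sum_abs x)) (latticeTerms_add (hp m) (latticeTerms_neg (hp n))))
        (fun t => by
          have h1 := abs_le.1 (hp1 n t)
          have h2 := abs_le.1 (hp1 m t)
          have hS : 0 ≤ ∑ i, |t i| := Finset.sum_nonneg fun i _ => abs_nonneg _
          have h3 := mul_le_mul_of_nonneg_right hc hS
          show 0 ≤ c * ∑ i, |t i| + ((p m).1 t + -(p n).1 t)
          linarith)
      have h4 : (0 : E) ≤ c • u + ((p m).2 + -(p n).2) := this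
      rw [← sub_nonneg]
      convert h4 using 1; abel
    have hc : (1 / 2 : ℝ) ^ n + (1 / 2) ^ m ≤ 2 * (1 / 2) ^ n := by
      have := pow_le_pow_of_le_one (by norm_num : (0 : ℝ) ≤ 1 / 2) (by norm_num) hnm
      linarith
    have hcu : (0 : E) ≤ (2 * (1 / 2 : ℝ) ^ n) • u := smul_nonneg (by positivity) hu0
    have h5 : ‖(p n).2 - (p m).2‖ ≤ ‖(2 * (1 / 2 : ℝ) ^ n) • u‖ := by
      refine HasSolidNorm.solid ?_
      rw [abs_of_nonneg hcu]
      refine abs_le'.2 ⟨key n m _ hc, ?_⟩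
      rw [neg_sub]
      exact key m n _ (by linarith)
    rwa [norm_smul, Real.norm_of_nonneg (by positivity)] at h5
  have hlim : Filter.Tendsto (fun n : ℕ => 2 * (1 / 2 : ℝ) ^ n * ‖u‖) Filter.atTop (nhds 0) := by
    have := tendsto_pow_atTop_nhds_zero_of_lt_one (by norm_num : (0 : ℝ) ≤ 1 / 2) (by norm_num)
    simpa using (this.const_mul 2).mul_const ‖u‖
  have hc : CauchySeq fun n => (p n).2 := by
    refine cauchySeq_of_le_tendsto_0 (fun n => 2 * (2 * (1 / 2 : ℝ) ^ n * ‖u‖)) ?_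
      (by simpa using hlim.const_mul 2)
    intro n m N hn hm
    have h1 := hb N n hn
    have h2 := hb N m hm
    rw [dist_eq_norm]
    calc ‖(p n).2 - (p m).2‖ = ‖((p N).2 - (p m).2) - ((p N).2 - (p n).2)‖ := by congr 1; abel
      _ ≤ _ := norm_sub_le _ _
      _ ≤ _ := by linarith
  obtain ⟨z, hz⟩ := cauchySeq_tendsto_of_complete hc
  refine ⟨z, fun ε hε => ?_⟩
  have e1 : ∀ᶠ n in Filter.atTop, ‖z - (p n).2‖ < ε := by
    filter_upwards [Metric.tendsto_nhds.1 hz ε hε] with n hn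
    rwa [dist_comm, dist_eq_norm] at hn
  have e2 : ∀ᶠ n : ℕ in Filter.atTop, (1 / 2 : ℝ) ^ n < ε :=
    (tendsto_pow_atTop_nhds_zero_of_lt_one (by norm_num : (0 : ℝ) ≤ 1 / 2)
      (by norm_num)).eventually_lt_const hε
  obtain ⟨n, h1, h2⟩ := (e1.and e2).exists
  refine ⟨p n, hp n, fun t => (hp1 n t).trans ?_, h1.le⟩
  gcongr

/-- A Krivine functional calculus at `x`: a linear map preserving finite suprema and sending the
coordinate functions to the entries of `x`. -/
def IsKrivineCalculus (x : ι → E) (T : PosHom ι →ₗ[ℝ] E) : Prop :=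
  (∀ f g, T (f ⊔ g) = T f ⊔ T g) ∧ ∀ i, T (PosHom.proj i) = x i

theorem IsKrivineCalculus.rel {x : ι → E} {T : PosHom ι →ₗ[ℝ] E} (hT : IsKrivineCalculus x T)
    (h : PosHom ι) : KrivineRel x h (T h) := by
  classical
  have hinf : ∀ f g, T (f ⊓ g) = T f ⊓ T g := by
    intro f g
    have h1 : f ⊓ g = -(-f ⊔ -g) := by
      apply Subtype.ext; funext t
      show min (f.1 t) (g.1 t) = -max (-f.1 t) (-g.1 t)
      rw [max_neg_neg, neg_neg]
    rw [h1, map_neg, hT.1, map_neg, map_neg, neg_sup, neg_neg, neg_neg]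
  have hmono : ∀ f g : PosHom ι, (∀ t, f.1 t ≤ g.1 t) → T f ≤ T g := by
    intro f g hfg
    have : f ⊔ g = g := sup_eq_right.2 hfg
    rw [← this, hT.1]; exact le_sup_left
  have hterm : latticeTerms x ⊆ {p | ∃ hp : p.1 ∈ PosHom ι, T ⟨p.1, hp⟩ = p.2} := by
    refine latticeClosure_min ?_ ⟨?_, ?_⟩
    · rintro _ ⟨a, rfl⟩
      refine ⟨latticeTerms_posHom (latticeTerms_lin x a), ?_⟩
      have : (⟨_, latticeTerms_posHom (latticeTerms_lin x a)⟩ : PosHom ι)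
          = ∑ i, a i • PosHom.proj i := by
        apply Subtype.ext
        funext t
        simp [PosHom.proj]
      rw [this, map_sum]
      simp [hT.2]
    · rintro u ⟨hu, hu'⟩ v ⟨hv, hv'⟩
      exact ⟨((⟨_, hu⟩ : PosHom ι) ⊔ ⟨_, hv⟩).2,
        (hT.1 ⟨_, hu⟩ ⟨_, hv⟩).trans (by rw [hu', hv']; rfl)⟩
    · rintro u ⟨hu, hu'⟩ v ⟨hv, hv'⟩
      exact ⟨((⟨_, hu⟩ : PosHom ι) ⊓ ⟨_, hv⟩).2,
        (hinf ⟨_, hu⟩ ⟨_, hv⟩).trans (by rw [hu', hv']; rfl)⟩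
  intro ε hε
  set u : E := ∑ i, |x i| with hu
  have hu0 : 0 ≤ u := Finset.sum_nonneg fun i _ => abs_nonneg _
  have hn : 0 < 1 + ‖u‖ := by positivity
  set δ := ε / (1 + ‖u‖) with hδ
  have hδ0 : 0 < δ := by positivity
  have hδe : δ * (1 + ‖u‖) = ε := by rw [hδ]; field_simp
  obtain ⟨p, hp, hp1⟩ := latticeTerms_dense x h hδ0
  have hδε : δ ≤ ε := by nlinarith [norm_nonneg u]
  refine ⟨p, hp, fun t => (hp1 t).trans ?_, ?_⟩
  · gcongr
  · obtain ⟨hp', hpT⟩ := hterm hp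
    obtain ⟨hS', hST⟩ := hterm (latticeTerms_smul δ (latticeTerms_sum_abs x))
    have h1 : T h - p.2 ≤ δ • u := by
      have := hmono (h - ⟨p.1, hp'⟩) ⟨_, hS'⟩ fun t => (abs_le.1 (hp1 t)).2
      rw [hST, map_sub, hpT] at this
      exact this
    have h2 : -(T h - p.2) ≤ δ • u := by
      have := hmono (⟨p.1, hp'⟩ - h) ⟨_, hS'⟩ fun t => by
        have := (abs_le.1 (hp1 t)).1
        show p.1 t - h.1 t ≤ δ * ∑ i, |t i|
        linarith
      rw [hST, map_sub, hpT] at this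
      rw [neg_sub]; exact this
    have h3 : ‖T h - p.2‖ ≤ ‖δ • u‖ := by
      refine HasSolidNorm.solid ?_
      rw [abs_of_nonneg (smul_nonneg hδ0.le hu0)]
      exact abs_le'.2 ⟨h1, h2⟩
    rw [norm_smul, Real.norm_of_nonneg hδ0.le] at h3
    nlinarith [norm_nonneg u]

theorem existsUnique_krivine [CompleteSpace E] (x : ι → E) :
    ∃! T : PosHom ι →ₗ[ℝ] E, IsKrivineCalculus x T := by
  classical
  choose z hz using KrivineRel.exists x
  refine ⟨⟨⟨z, fun f g => (hz _).unique ((hz f).add (hz g))⟩,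
    fun c f => (hz _).unique ((hz f).smul c)⟩,
    ⟨fun f g => (hz _).unique ((hz f).sup (hz g)), fun i => ?_⟩, fun T hT => ?_⟩
  · refine (hz _).unique ?_
    have := KrivineRel.of_term (h := PosHom.proj i) (latticeTerms_lin x (Pi.single i 1))
      (by funext t; simp [PosHom.proj, Pi.single_apply])
    simpa [Pi.single_apply, ite_smul] using this
  · exact LinearMap.ext fun h => (hT.rel h).unique (hz h)

variable [CompleteSpace E]

/-- The Krivine functional calculus at `x`: the unique linear lattice homomorphism from the
continuous positively homogeneous functions to `E` sending the coordinate functions to the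
entries of `x`. -/
def krivine (x : ι → E) : PosHom ι →ₗ[ℝ] E := (existsUnique_krivine x).choose

theorem isKrivineCalculus_krivine (x : ι → E) : IsKrivineCalculus x (krivine x) :=
  (existsUnique_krivine x).choose_spec.1

theorem krivine_unique {x : ι → E} {T : PosHom ι →ₗ[ℝ] E} (hT : IsKrivineCalculus x T) :
    T = krivine x := (existsUnique_krivine x).choose_spec.2 T hT

theorem krivine_sup (x : ι → E) (f g : PosHom ι) : krivine x (f ⊔ g) = krivine x f ⊔ krivine x g :=
  (isKrivineCalculus_krivine x).1 f g

theorem krivine_proj (x : ι → E) (i : ι) : krivine x (PosHom.proj i) = x i :=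
  (isKrivineCalculus_krivine x).2 i

theorem krivine_mono (x : ι → E) {f g : PosHom ι} (h : ∀ t, f.1 t ≤ g.1 t) :
    krivine x f ≤ krivine x g := by
  have : f ⊔ g = g := sup_eq_right.2 h
  rw [← this, krivine_sup]; exact le_sup_left

theorem krivine_comp {κ : Type*} [Fintype κ] (x : ι → E) (g : κ → PosHom ι) (h : PosHom κ) :
    krivine (fun j => krivine x (g j)) h = krivine x (PosHom.comp h g) := by
  let T : PosHom κ →ₗ[ℝ] E :=
    { toFun := fun h => krivine x (PosHom.comp h g)
      map_add' := fun a b => (map_add (krivine x) (PosHom.comp a g) (PosHom.comp b g))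
      map_smul' := fun c a => (map_smul (krivine x) c (PosHom.comp a g)) }
  have : T = krivine (fun j => krivine x (g j)) :=
    krivine_unique ⟨fun a b => krivine_sup x (PosHom.comp a g) (PosHom.comp b g), fun i => rfl⟩
  rw [← this]; rfl

end Krivine

section KrivineTools

variable {ι : Type*} [Fintype ι] {E : Type*} [NormedAddCommGroup E] [NormedSpace ℝ E] [Lattice E]
  [HasSolidNorm E] [IsOrderedAddMonoid E] [IsOrderedModule ℝ E] [CompleteSpace E]

theorem krivine_comp₂ (X : ι → E) (h : PosHom (Fin 2)) (a b : PosHom ι) :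
    krivine ![krivine X a, krivine X b] h = krivine X (PosHom.comp h ![a, b]) := by
  rw [← krivine_comp]
  congr 1
  congr 1
  funext j
  fin_cases j <;> rfl

theorem krivine_proj_sup_neg (X : ι → E) (i : ι) :
    krivine X (PosHom.proj i ⊔ -PosHom.proj i) = |X i| := by
  rw [krivine_sup, map_neg, krivine_proj]; rfl

theorem norm_krivine_le (X : ι → E) {h g : PosHom ι} (hg : ∀ t, |h.1 t| ≤ g.1 t) :
    ‖krivine X h‖ ≤ ‖krivine X g‖ := by
  refine HasSolidNorm.solid (le_trans ?_ (le_abs_self _))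
  refine abs_le'.2 ⟨krivine_mono X fun t => (le_abs_self _).trans (hg t), ?_⟩
  rw [← map_neg]
  exact krivine_mono X fun t => (neg_le_abs _).trans (hg t)

theorem norm_krivine_le_add (X : Fin 2 → E) {h : PosHom (Fin 2)} {a b : ℝ} (ha : 0 ≤ a)
    (hb : 0 ≤ b) (hh : ∀ t, |h.1 t| ≤ a * |t 0| + b * |t 1|) :
    ‖krivine X h‖ ≤ a * ‖X 0‖ + b * ‖X 1‖ := by
  refine (norm_krivine_le X (g := a • (PosHom.proj 0 ⊔ -PosHom.proj 0)
    + b • (PosHom.proj 1 ⊔ -PosHom.proj 1)) hh).trans ?_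
  rw [map_add, map_smul, map_smul, krivine_proj_sup_neg, krivine_proj_sup_neg]
  refine (norm_add_le _ _).trans ?_
  rw [norm_smul, norm_smul, norm_abs_eq_norm, norm_abs_eq_norm, Real.norm_of_nonneg ha,
    Real.norm_of_nonneg hb]

end KrivineTools

/-- The sign-preserving power `s ↦ sign(s) |s|^r`. -/
def signPow (r s : ℝ) : ℝ := SignType.sign s * |s| ^ r

theorem signPow_zero {r : ℝ} : signPow r 0 = 0 := by simp [signPow]

theorem signPow_one {r : ℝ} : signPow r 1 = 1 := by simp [signPow]

theorem signPow_of_nonneg {r s : ℝ} (hr : 0 < r) (hs : 0 ≤ s) : signPow r s = s ^ r := by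
  rcases hs.eq_or_lt with rfl | hs
  · simp [signPow, Real.zero_rpow hr.ne']
  · simp [signPow, sign_pos hs, abs_of_pos hs]

theorem signPow_neg (r s : ℝ) : signPow r (-s) = -signPow r s := by
  simp [signPow, Left.sign_neg]

theorem signPow_mul (r s t : ℝ) : signPow r (s * t) = signPow r s * signPow r t := by
  simp only [signPow, sign_mul, abs_mul, SignType.coe_mul,
    Real.mul_rpow (abs_nonneg s) (abs_nonneg t)]
  ring

theorem abs_signPow {r : ℝ} (hr : 0 < r) (s : ℝ) : |signPow r s| = |s| ^ r := by
  rcases le_total 0 s with hs | hs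
  · rw [signPow_of_nonneg hr hs, abs_of_nonneg (Real.rpow_nonneg hs r), abs_of_nonneg hs]
  · have h := signPow_of_nonneg hr (neg_nonneg.2 hs)
    rw [← abs_neg, ← signPow_neg, h, abs_of_nonneg (Real.rpow_nonneg (neg_nonneg.2 hs) r),
      abs_of_nonpos hs]

theorem signPow_signPow {r q : ℝ} (hr : 0 < r) (hq : 0 < q) (hrq : r * q = 1) (s : ℝ) :
    signPow r (signPow q s) = s := by
  have key : ∀ s : ℝ, 0 ≤ s → signPow r (signPow q s) = s := by
    intro s hs
    rw [signPow_of_nonneg hq hs, signPow_of_nonneg hr (Real.rpow_nonneg hs q), ← Real.rpow_mul hs,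
      mul_comm, hrq, Real.rpow_one]
  rcases le_total 0 s with hs | hs
  · exact key s hs
  · have := key (-s) (by linarith)
    rw [signPow_neg, signPow_neg] at this
    linarith

theorem continuous_signPow {r : ℝ} (hr : 0 < r) : Continuous (signPow r) := by
  have : signPow r = fun s => (max s 0) ^ r - (max (-s) 0) ^ r := by
    funext s
    rcases le_total 0 s with hs | hs
    · rw [signPow_of_nonneg hr hs, max_eq_left hs, max_eq_right (by linarith),
        Real.zero_rpow hr.ne', sub_zero]
    · have h := signPow_of_nonneg hr (neg_nonneg.2 hs)
      rw [signPow_neg] at h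
      rw [max_eq_right hs, max_eq_left (by linarith), Real.zero_rpow hr.ne', ← h]
      ring
  rw [this]
  exact ((continuous_id.max continuous_const).rpow_const fun _ => Or.inr hr.le).sub
    ((continuous_neg.max continuous_const).rpow_const fun _ => Or.inr hr.le)

/-- The function `(s, t) ↦ (s^{1/p} + t^{1/p})^p`, powers being sign-preserving. -/
def convexificationAdd (p : ℝ) (hp : 1 ≤ p) : PosHom (Fin 2) :=
  ⟨fun t => signPow p (signPow (1 / p) (t 0) + signPow (1 / p) (t 1)), by
    have hp0 : 0 < p := by linarith
    have hq0 : 0 < 1 / p := by positivity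
    refine ⟨(continuous_signPow hp0).comp
      (((continuous_signPow hq0).comp (continuous_apply 0)).add
        ((continuous_signPow hq0).comp (continuous_apply 1))), fun c hc t => ?_⟩
    have h1 := signPow_signPow hp0 hq0 (by field_simp) c
    simp only [Pi.smul_apply, smul_eq_mul, signPow_mul, ← mul_add]
    rw [h1]⟩

/-- The function `(s, t) ↦ (|s|^p + |t|^p)^{1/p}`. -/
def powerSum (p : ℝ) (hp : 1 ≤ p) : PosHom (Fin 2) :=
  ⟨fun t => (|t 0| ^ p + |t 1| ^ p) ^ (1 / p), by
    have hp0 : 0 < p := by linarith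
    refine ⟨?_, fun c hc t => ?_⟩
    · refine Continuous.rpow_const ?_ fun _ => Or.inr (by positivity)
      exact (((continuous_apply 0).abs).rpow_const fun _ => Or.inr hp0.le).add
        (((continuous_apply 1).abs).rpow_const fun _ => Or.inr hp0.le)
    · simp only [Pi.smul_apply, smul_eq_mul, abs_mul, abs_of_nonneg hc]
      rw [Real.mul_rpow hc (abs_nonneg _), Real.mul_rpow hc (abs_nonneg _), ← mul_add,
        Real.mul_rpow (by positivity) (by positivity), ← Real.rpow_mul hc,
        mul_one_div_cancel hp0.ne', Real.rpow_one]⟩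

/-- The function `(s, t) ↦ (s^2 + t^2)^{1/2}`. -/
def euclideanModulus : PosHom (Fin 2) :=
  ⟨fun t => √(t 0 ^ 2 + t 1 ^ 2), by fun_prop, fun c hc t => by
    simp only [Pi.smul_apply, smul_eq_mul, mul_pow, ← mul_add]
    rw [Real.sqrt_mul (sq_nonneg c), Real.sqrt_sq hc]⟩

/-- The `p`-convexification `E^(p)` of a Banach lattice `E`: the set `E` with the operations
`x ⊕ y = (x^{1/p} + y^{1/p})^p`, `a ⊙ x = a^p x` (powers being sign-preserving) and the norm
`‖x‖^{1/p}`. -/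
@[ext]
structure Convexification (E : Type*) (p : ℝ) (hp : 1 ≤ p) where
  /-- The underlying element of `E`. -/
  val : E

namespace Convexification

variable {E : Type*} [NormedAddCommGroup E] [NormedSpace ℝ E] [Lattice E]
  [HasSolidNorm E] [IsOrderedAddMonoid E] [IsOrderedModule ℝ E] [CompleteSpace E]
  {p : ℝ} {hp : 1 ≤ p}

instance : Add (Convexification E p hp) :=
  ⟨fun x y => ⟨krivine ![x.val, y.val] (convexificationAdd p hp)⟩⟩

instance : Zero (Convexification E p hp) := ⟨⟨0⟩⟩

instance : Neg (Convexification E p hp) := ⟨fun x => ⟨-x.val⟩⟩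

instance : SMul ℝ (Convexification E p hp) := ⟨fun a x => ⟨signPow p a • x.val⟩⟩

instance : Norm (Convexification E p hp) := ⟨fun x => ‖x.val‖ ^ (1 / p)⟩

theorem val_add (x y : Convexification E p hp) :
    (x + y).val = krivine ![x.val, y.val] (convexificationAdd p hp) := rfl

theorem val_zero : (0 : Convexification E p hp).val = 0 := rfl

theorem val_neg (x : Convexification E p hp) : (-x).val = -x.val := rfl

theorem val_smul (a : ℝ) (x : Convexification E p hp) : (a • x).val = signPow p a • x.val := rfl

theorem norm_def (x : Convexification E p hp) : ‖x‖ = ‖x.val‖ ^ (1 / p) := rfl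

theorem signPow_p (hp : 1 ≤ p) (s : ℝ) : signPow p (signPow (1 / p) s) = s :=
  signPow_signPow (by linarith) (by have : 0 < p := by linarith
                                    positivity) (by have : 0 < p := by linarith
                                                    field_simp) s

theorem signPow_p' (hp : 1 ≤ p) (s : ℝ) : signPow (1 / p) (signPow p s) = s :=
  signPow_signPow (by have : 0 < p := by linarith
                      positivity) (by linarith) (by have : 0 < p := by linarith
                                                    field_simp) s

theorem add_assoc_aux {ι : Type*} [Fintype ι] (X : ι → E) (a b c : PosHom ι) :
    krivine ![krivine ![krivine X a, krivine X b] (convexificationAdd p hp), krivine X c]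
      (convexificationAdd p hp) =
    krivine ![krivine X a, krivine ![krivine X b, krivine X c] (convexificationAdd p hp)]
      (convexificationAdd p hp) := by
  rw [krivine_comp₂, krivine_comp₂, krivine_comp₂, krivine_comp₂]
  congr 1
  apply Subtype.ext; funext t
  simp [PosHom.comp, convexificationAdd, ← one_div, signPow_p' hp, add_assoc]

instance : AddCommGroup (Convexification E p hp) where
  add_assoc x y z := by
    apply Convexification.ext
    have := add_assoc_aux (hp := hp) ![x.val, y.val, z.val] (PosHom.proj 0) (PosHom.proj 1)
      (PosHom.proj 2)
    simpa [krivine_proj, val_add] using this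
  zero_add x := by
    apply Convexification.ext
    have := krivine_comp₂ (fun _ : Fin 1 => x.val) (convexificationAdd p hp) 0 (PosHom.proj 0)
    rw [map_zero, krivine_proj] at this
    rw [val_add, val_zero, this]
    refine Eq.trans ?_ (krivine_proj (fun _ : Fin 1 => x.val) 0)
    congr 1
    apply Subtype.ext; funext t
    simp [PosHom.comp, PosHom.proj, convexificationAdd, ← one_div, signPow_p hp, signPow_zero]
  add_zero x := by
    apply Convexification.ext
    have := krivine_comp₂ (fun _ : Fin 1 => x.val) (convexificationAdd p hp) (PosHom.proj 0) 0
    rw [map_zero, krivine_proj] at this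
    rw [val_add, val_zero, this]
    refine Eq.trans ?_ (krivine_proj (fun _ : Fin 1 => x.val) 0)
    congr 1
    apply Subtype.ext; funext t
    simp [PosHom.comp, PosHom.proj, convexificationAdd, ← one_div, signPow_p hp, signPow_zero]
  neg_add_cancel x := by
    apply Convexification.ext
    have := krivine_comp₂ (fun _ : Fin 1 => x.val) (convexificationAdd p hp) (-PosHom.proj 0)
      (PosHom.proj 0)
    rw [map_neg, krivine_proj] at this
    rw [val_add, val_neg, val_zero, this, ← map_zero (krivine fun _ : Fin 1 => x.val)]
    congr 1
    apply Subtype.ext; funext t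
    simp [PosHom.comp, PosHom.proj, convexificationAdd, ← one_div, signPow_neg, signPow_zero]
  add_comm x y := by
    apply Convexification.ext
    have := krivine_comp₂ ![x.val, y.val] (convexificationAdd p hp) (PosHom.proj 1)
      (PosHom.proj 0)
    rw [krivine_proj, krivine_proj] at this
    rw [val_add, val_add]
    refine Eq.trans ?_ this.symm
    congr 1
    apply Subtype.ext; funext t
    simp [PosHom.comp, PosHom.proj, convexificationAdd, add_comm]
  nsmul := nsmulRec
  zsmul := zsmulRec

instance : Module ℝ (Convexification E p hp) where
  one_smul x := by
    apply Convexification.ext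
    rw [val_smul, signPow_one, one_smul]
  mul_smul a b x := by
    apply Convexification.ext
    rw [val_smul, val_smul, val_smul, signPow_mul, mul_smul]
  smul_zero a := by
    apply Convexification.ext
    rw [val_smul, val_zero, smul_zero]
  zero_smul x := by
    apply Convexification.ext
    rw [val_smul, signPow_zero, val_zero, zero_smul]
  smul_add a x y := by
    apply Convexification.ext
    have := krivine_comp₂ ![x.val, y.val] (convexificationAdd p hp)
      (signPow p a • PosHom.proj 0) (signPow p a • PosHom.proj 1)
    rw [map_smul, map_smul, krivine_proj, krivine_proj] at this
    rw [val_smul, val_add, val_add, val_smul, val_smul, ← map_smul]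
    refine Eq.trans ?_ this.symm
    congr 1
    apply Subtype.ext; funext t
    simp [PosHom.comp, PosHom.proj, convexificationAdd, ← one_div, signPow_mul, signPow_p' hp,
      ← mul_add]
  add_smul a b x := by
    apply Convexification.ext
    have := krivine_comp₂ (fun _ : Fin 1 => x.val) (convexificationAdd p hp)
      (signPow p a • PosHom.proj 0) (signPow p b • PosHom.proj 0)
    rw [map_smul, map_smul, krivine_proj] at this
    rw [val_add, val_smul, val_smul, val_smul, this]
    have h2 : signPow p (a + b) • x.val =
        krivine (fun _ : Fin 1 => x.val) (signPow p (a + b) • PosHom.proj 0) := by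
      rw [map_smul, krivine_proj]
    rw [h2]
    congr 1
    apply Subtype.ext; funext t
    simp [PosHom.comp, PosHom.proj, convexificationAdd, ← one_div, signPow_mul, signPow_p' hp,
      signPow_p hp, ← add_mul]

theorem norm_add_le' (x y : Convexification E p hp) : ‖x + y‖ ≤ ‖x‖ + ‖y‖ := by
  have hp0 : 0 < p := by linarith
  have hq0 : 0 < 1 / p := by positivity
  have hz : ∀ z : Convexification E p hp, ‖z‖ = 0 → z = 0 := by
    intro z hz
    rw [norm_def, Real.rpow_eq_zero (norm_nonneg _) hq0.ne', norm_eq_zero] at hz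
    exact Convexification.ext hz
  have hnn : ∀ z : Convexification E p hp, 0 ≤ ‖z‖ := fun z => Real.rpow_nonneg (norm_nonneg _) _
  rcases (hnn x).eq_or_lt with hx | hA
  · rw [hz x hx.symm, zero_add]; linarith [hnn (0 : Convexification E p hp)]
  rcases (hnn y).eq_or_lt with hy | hB
  · rw [hz y hy.symm, add_zero]; linarith [hnn (0 : Convexification E p hp)]
  set A := ‖x‖ with hAdef
  set B := ‖y‖ with hBdef
  have hxA : ‖x.val‖ = A ^ p := by
    rw [hAdef, norm_def, ← Real.rpow_mul (norm_nonneg _), one_div_mul_cancel hp0.ne', Real.rpow_one]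
  have hyB : ‖y.val‖ = B ^ p := by
    rw [hBdef, norm_def, ← Real.rpow_mul (norm_nonneg _), one_div_mul_cancel hp0.ne', Real.rpow_one]
  have hl : 0 < A / (A + B) := by positivity
  have hm : 0 < B / (A + B) := by positivity
  have hlm : A / (A + B) + B / (A + B) = 1 := by field_simp
  set l := A / (A + B) with hldef
  set m := B / (A + B) with hmdef
  have key : ‖(x + y).val‖ ≤ (l * (1 / l) ^ p) * ‖x.val‖ + (m * (1 / m) ^ p) * ‖y.val‖ := by
    refine norm_krivine_le_add ![x.val, y.val] (by positivity) (by positivity) fun t => ?_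
    have hr : ∀ s : ℝ, (|s| ^ (1 / p)) ^ p = |s| := fun s => by
      rw [← Real.rpow_mul (abs_nonneg _), one_div_mul_cancel hp0.ne', Real.rpow_one]
    calc |(convexificationAdd p hp).1 t|
        = |signPow (1 / p) (t 0) + signPow (1 / p) (t 1)| ^ p := abs_signPow hp0 _
      _ ≤ (|t 0| ^ (1 / p) + |t 1| ^ (1 / p)) ^ p := by
          refine Real.rpow_le_rpow (abs_nonneg _) ?_ hp0.le
          rw [← abs_signPow hq0, ← abs_signPow hq0]
          exact abs_add_le _ _
      _ = (l * (1 / l * |t 0| ^ (1 / p)) + m * (1 / m * |t 1| ^ (1 / p))) ^ p := by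
          congr 1; field_simp
      _ ≤ l * (1 / l * |t 0| ^ (1 / p)) ^ p + m * (1 / m * |t 1| ^ (1 / p)) ^ p :=
          (convexOn_rpow hp).2 (Set.mem_Ici.2 (by positivity)) (Set.mem_Ici.2 (by positivity))
            hl.le hm.le hlm
      _ = _ := by
          rw [Real.mul_rpow (by positivity) (by positivity),
            Real.mul_rpow (by positivity) (by positivity), hr, hr]
          ring
  have hsum : (l * (1 / l) ^ p) * ‖x.val‖ + (m * (1 / m) ^ p) * ‖y.val‖ = (A + B) ^ p := by
    have h1 : 1 / l * A = A + B := by rw [hldef]; field_simp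
    have h2 : 1 / m * B = A + B := by rw [hmdef]; field_simp
    rw [hxA, hyB, mul_assoc, mul_assoc, ← Real.mul_rpow (by positivity) hA.le,
      ← Real.mul_rpow (by positivity) hB.le, h1, h2, ← add_mul, hlm, one_mul]
  rw [hsum] at key
  calc ‖x + y‖ = ‖(x + y).val‖ ^ (1 / p) := rfl
    _ ≤ ((A + B) ^ p) ^ (1 / p) := Real.rpow_le_rpow (norm_nonneg _) key hq0.le
    _ = A + B := by
      rw [← Real.rpow_mul (by positivity), mul_one_div_cancel hp0.ne', Real.rpow_one]

theorem core : NormedSpace.Core ℝ (Convexification E p hp) where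
  norm_nonneg x := Real.rpow_nonneg (norm_nonneg _) _
  norm_smul a x := by
    have hp0 : 0 < p := by linarith
    rw [norm_def, norm_def, val_smul, norm_smul, Real.mul_rpow (norm_nonneg _) (norm_nonneg _),
      Real.norm_eq_abs, abs_signPow hp0, ← Real.rpow_mul (abs_nonneg _),
      mul_one_div_cancel hp0.ne', Real.rpow_one, Real.norm_eq_abs]
  norm_triangle x y := norm_add_le' x y
  norm_eq_zero_iff x := by
    have hp0 : 0 < p := by linarith
    have hq0 : 0 < 1 / p := by positivity
    rw [norm_def, Real.rpow_eq_zero (norm_nonneg _) hq0.ne', norm_eq_zero]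
    exact ⟨fun h => Convexification.ext h, fun h => by rw [h, val_zero]⟩

instance : NormedAddCommGroup (Convexification E p hp) := NormedAddCommGroup.ofCore core

instance : NormedSpace ℝ (Convexification E p hp) := NormedSpace.ofCore core

end Convexification

/-- The complexification `E^ℂ = E ⊕ iE` of a Banach lattice `E`, with the norm
`‖x + iy‖ = ‖(|x|^2 + |y|^2)^{1/2}‖`. -/
@[ext]
structure LatticeComplexification (E : Type*) where
  /-- The real part. -/
  re : E
  /-- The imaginary part. -/
  im : E

namespace LatticeComplexification

variable {E : Type*} [NormedAddCommGroup E] [NormedSpace ℝ E] [Lattice E]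
  [HasSolidNorm E] [IsOrderedAddMonoid E] [IsOrderedModule ℝ E] [CompleteSpace E]

instance : Add (LatticeComplexification E) := ⟨fun z w => ⟨z.re + w.re, z.im + w.im⟩⟩

instance : Zero (LatticeComplexification E) := ⟨⟨0, 0⟩⟩

instance : Neg (LatticeComplexification E) := ⟨fun z => ⟨-z.re, -z.im⟩⟩

instance : SMul ℂ (LatticeComplexification E) :=
  ⟨fun c z => ⟨c.re • z.re - c.im • z.im, c.re • z.im + c.im • z.re⟩⟩

instance : Norm (LatticeComplexification E) :=
  ⟨fun z => ‖krivine ![z.re, z.im] euclideanModulus‖⟩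

@[simp] theorem re_add (z w : LatticeComplexification E) : (z + w).re = z.re + w.re := rfl
@[simp] theorem im_add (z w : LatticeComplexification E) : (z + w).im = z.im + w.im := rfl
@[simp] theorem re_zero : (0 : LatticeComplexification E).re = 0 := rfl
@[simp] theorem im_zero : (0 : LatticeComplexification E).im = 0 := rfl
@[simp] theorem re_neg (z : LatticeComplexification E) : (-z).re = -z.re := rfl
@[simp] theorem im_neg (z : LatticeComplexification E) : (-z).im = -z.im := rfl
@[simp] theorem re_smul (c : ℂ) (z : LatticeComplexification E) :
    (c • z).re = c.re • z.re - c.im • z.im := rfl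
@[simp] theorem im_smul (c : ℂ) (z : LatticeComplexification E) :
    (c • z).im = c.re • z.im + c.im • z.re := rfl

theorem norm_def (z : LatticeComplexification E) :
    ‖z‖ = ‖krivine ![z.re, z.im] euclideanModulus‖ := rfl

instance : AddCommGroup (LatticeComplexification E) where
  add_assoc x y z := by ext <;> simp [add_assoc]
  zero_add x := by ext <;> simp
  add_zero x := by ext <;> simp
  neg_add_cancel x := by ext <;> simp
  add_comm x y := by ext <;> simp [add_comm]
  nsmul := nsmulRec
  zsmul := zsmulRec

instance : Module ℂ (LatticeComplexification E) where
  one_smul x := by ext <;> simp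
  mul_smul a b x := by
    ext
    · simp; module
    · simp; module
  smul_zero a := by ext <;> simp
  zero_smul x := by ext <;> simp
  smul_add a x y := by
    ext
    · simp; module
    · simp; module
  add_smul a b x := by
    ext
    · simp; module
    · simp; module

theorem core : NormedSpace.Core ℂ (LatticeComplexification E) where
  norm_nonneg z := norm_nonneg (krivine ![z.re, z.im] euclideanModulus)
  norm_smul c z := by
    have h := krivine_comp₂ ![z.re, z.im] euclideanModulus
      (c.re • PosHom.proj 0 - c.im • PosHom.proj 1) (c.re • PosHom.proj 1 + c.im • PosHom.proj 0)
    simp only [map_sub, map_add, map_smul, krivine_proj] at h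
    have h2 : PosHom.comp euclideanModulus ![c.re • PosHom.proj 0 - c.im • PosHom.proj 1,
        c.re • PosHom.proj 1 + c.im • PosHom.proj 0] = ‖c‖ • euclideanModulus := by
      apply Subtype.ext; funext t
      show √((c.re * t 0 - c.im * t 1) ^ 2 + (c.re * t 1 + c.im * t 0) ^ 2) =
        ‖c‖ * √(t 0 ^ 2 + t 1 ^ 2)
      rw [Complex.norm_def, ← Real.sqrt_mul (Complex.normSq_nonneg c), Complex.normSq_apply]
      congr 1; ring
    rw [h2, map_smul] at h
    rw [norm_def, norm_def, ← norm_norm c, ← norm_smul, ← h]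
    rfl
  norm_triangle z w := by
    let X : Fin 4 → E := ![z.re, z.im, w.re, w.im]
    have h1 := krivine_comp₂ X euclideanModulus (PosHom.proj 0) (PosHom.proj 1)
    have h2 := krivine_comp₂ X euclideanModulus (PosHom.proj 2) (PosHom.proj 3)
    have h3 := krivine_comp₂ X euclideanModulus (PosHom.proj 0 + PosHom.proj 2)
      (PosHom.proj 1 + PosHom.proj 3)
    simp only [map_add, krivine_proj] at h1 h2 h3
    have e1 : ‖z‖ = ‖krivine X (PosHom.comp euclideanModulus ![PosHom.proj 0, PosHom.proj 1])‖ := by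
      rw [← h1]; rfl
    have e2 : ‖w‖ = ‖krivine X (PosHom.comp euclideanModulus ![PosHom.proj 2, PosHom.proj 3])‖ := by
      rw [← h2]; rfl
    have e3 : ‖z + w‖ = ‖krivine X (PosHom.comp euclideanModulus
        ![PosHom.proj 0 + PosHom.proj 2, PosHom.proj 1 + PosHom.proj 3])‖ := by
      rw [← h3]; rfl
    rw [e1, e2, e3]
    refine (norm_krivine_le X fun t => ?_).trans ((congrArg norm (map_add (krivine X) _ _)).le.trans
      (norm_add_le _ _))
    show |√((t 0 + t 2) ^ 2 + (t 1 + t 3) ^ 2)| ≤ √(t 0 ^ 2 + t 1 ^ 2) + √(t 2 ^ 2 + t 3 ^ 2)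
    rw [abs_of_nonneg (Real.sqrt_nonneg _)]
    have := norm_add_le (⟨t 0, t 1⟩ : ℂ) ⟨t 2, t 3⟩
    simpa [Complex.norm_def, Complex.normSq_apply, ← sq] using this
  norm_eq_zero_iff z := by
    rw [norm_def]
    constructor
    · intro h
      have key : ∀ i : Fin 2, ![z.re, z.im] i = 0 := by
        intro i
        have h1 := norm_krivine_le ![z.re, z.im] (h := PosHom.proj i) (g := euclideanModulus)
          (fun t => by
            show |t i| ≤ √(t 0 ^ 2 + t 1 ^ 2)
            refine Real.abs_le_sqrt ?_
            fin_cases i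
            · show t 0 ^ 2 ≤ _
              nlinarith [sq_nonneg (t 1)]
            · show t 1 ^ 2 ≤ _
              nlinarith [sq_nonneg (t 0)])
        rw [h, krivine_proj] at h1
        exact norm_eq_zero.1 (le_antisymm h1 (norm_nonneg _))
      exact LatticeComplexification.ext (key 0) (key 1)
    · rintro rfl
      have h1 := norm_krivine_le_add (![0, 0] : Fin 2 → E) (h := euclideanModulus) zero_le_one
        zero_le_one (fun t => by
          show |√(t 0 ^ 2 + t 1 ^ 2)| ≤ 1 * |t 0| + 1 * |t 1|
          rw [abs_of_nonneg (Real.sqrt_nonneg _), one_mul, one_mul]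
          refine Real.sqrt_le_iff.2 ⟨by positivity, ?_⟩
          nlinarith [sq_abs (t 0), sq_abs (t 1), abs_nonneg (t 0), abs_nonneg (t 1),
            mul_nonneg (abs_nonneg (t 0)) (abs_nonneg (t 1))])
      refine le_antisymm (h1.trans ?_) (norm_nonneg _)
      simp

instance : NormedAddCommGroup (LatticeComplexification E) := NormedAddCommGroup.ofCore core

instance : NormedSpace ℂ (LatticeComplexification E) := NormedSpace.ofCore core

end LatticeComplexification

/-- `x` is a strongly extreme point of the unit ball (for `x` of norm one). -/
def IsStronglyExtremePoint {X : Type*} [NormedAddCommGroup X] (x : X) : Prop :=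
  ∀ ε : ℝ, 0 < ε → ∃ δ : ℝ, 0 < δ ∧ ∀ y : X, ε ≤ ‖y‖ → 1 + δ ≤ max ‖x + y‖ ‖x - y‖

/-- Midpoint local uniform convexity: every point of the unit sphere is strongly extreme. -/
def MidpointLocallyUniformlyConvex (X : Type*) [NormedAddCommGroup X] [NormedSpace ℝ X] : Prop :=
  ∀ x : X, ‖x‖ = 1 → IsStronglyExtremePoint x

/-- `x` is a complex strongly extreme point of the unit ball (for `x` of norm one). -/
def IsComplexStronglyExtremePoint {X : Type*} [NormedAddCommGroup X] [NormedSpace ℂ X]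
    (x : X) : Prop :=
  ∃ p : ℝ, 0 < p ∧ ∀ ε : ℝ, 0 < ε → ∃ δ : ℝ, 0 < δ ∧ ∀ y : X, ε ≤ ‖y‖ →
    1 + δ ≤ (1 / (2 * Real.pi) *
      ∫ θ in (0 : ℝ)..(2 * Real.pi), ‖x + Complex.exp (θ * Complex.I) • y‖ ^ p) ^ (1 / p)

/-- Local uniform complex convexity: every point of the unit sphere is complex strongly extreme. -/
def LocallyUniformlyComplexConvex (X : Type*) [NormedAddCommGroup X] [NormedSpace ℂ X] : Prop :=
  ∀ x : X, ‖x‖ = 1 → IsComplexStronglyExtremePoint x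

section Monotonicity

variable (E : Type*) [NormedAddCommGroup E] [NormedSpace ℝ E] [Lattice E]
  [HasSolidNorm E] [IsOrderedAddMonoid E] [IsOrderedModule ℝ E]

/-- Upper local uniform monotonicity: for some `1 ≤ p < ∞`, for all `x` in the unit sphere and all
`ε > 0`, the infimum of `‖(|x|^p + |y|^p)^{1/p}‖ - 1` over `‖y‖ ≥ ε` is positive. -/
def UpperLocallyUniformlyMonotone [CompleteSpace E] : Prop :=
  ∃ (p : ℝ) (hp : 1 ≤ p), ∀ x : E, ‖x‖ = 1 → ∀ ε : ℝ, 0 < ε → ∃ δ : ℝ, 0 < δ ∧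
    ∀ y : E, ε ≤ ‖y‖ → 1 + δ ≤ ‖krivine ![x, y] (powerSum p hp)‖

end Monotonicity

/-- Order continuity of the norm: every downward directed set with infimum `0` converges to `0`
in norm. -/
def OrderContinuousNorm (E : Type*) [NormedAddCommGroup E] [Lattice E] : Prop :=
  ∀ S : Set E, S.Nonempty → DirectedOn (fun x y => y ≤ x) S → IsGLB S 0 →
    ∀ ε : ℝ, 0 < ε → ∃ x ∈ S, ∀ y ∈ S, y ≤ x → ‖y‖ < ε

/-- `E` is (lattice isometric to) a Köthe function space: over some complete `σ`-finite measure
space, it is an ideal of (classes of) measurable functions which are integrable on sets of finite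
measure, and it contains the characteristic functions of sets of finite measure. The lattice
operations are the pointwise ones, so the monotonicity of the norm is that of the Banach
lattice `E`. -/
def IsKotheFunctionSpace.{u, v} (E : Type u) [NormedAddCommGroup E] [NormedSpace ℝ E]
    [Lattice E] : Prop :=
  ∃ (Ω : Type v) (_ : MeasurableSpace Ω) (μ : MeasureTheory.Measure Ω)
    (J : E →ₗ[ℝ] (Ω →ₘ[μ] ℝ)),
    μ.IsComplete ∧ MeasureTheory.SigmaFinite μ ∧ Function.Injective J ∧
    (∀ x y, J (x ⊔ y) = J x ⊔ J y) ∧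
    (∀ (f : Ω →ₘ[μ] ℝ) (x : E), |f| ≤ |J x| → ∃ y, J y = f) ∧
    (∀ (x : E) (s : Set Ω), MeasurableSet s → μ s < ⊤ → MeasureTheory.IntegrableOn (J x) s μ) ∧
    (∀ s : Set Ω, MeasurableSet s → μ s < ⊤ →
      ∃ x : E, (J x : Ω → ℝ) =ᵐ[μ] s.indicator fun _ => (1 : ℝ))

end

universe u v

/-! All four conditions are forms of one statement. For a continuous, degree-one positively
homogeneous `N` on the plane with `N(s,t) ≥ |s|` and equality only for `t = 0`, ask that `‖N(x,y)‖`
exceed `1` by a fixed amount whenever `‖x‖ = 1` and `‖y‖ ≥ ε`. If this holds for one power sum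
`(|s|^r + |t|^r)^{1/r}`, it holds for every such `N` (`UpperMonotoneFor.of_absPowerSum`). Indeed `N`
is the power sum of `s` and `Z = (N^r - |s|^r)^{1/r}`. By compactness of the `ℓ¹` sphere, `|t| ≤
η(|s| + |t|) + C Z`, so `Z(x,y)` is bounded below in norm when `y` is. Scalar inequalities pass to
the lattice because the Krivine calculus is monotone and compatible with composition.

Midpoint convexity of the convexification: the moduli of `x ⊕ y` and `x ⊖ y` are both at most
`(|x|^{1/p} + |y|^{1/p})^p`, the power sum of exponent `1/p`. Conversely, strict convexity of `u ↦
u^p` for `p > 1` makes `(|x ⊕ y| + |x ⊖ y|)/2` an admissible `N`, and the larger of two norms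
dominates the norm of the mean.

Complex convexity: for real `x`, `y` every `|x + e^{iθ}y|` is at most `|x| + |y|`, the power sum of
exponent `1`. Conversely, the mean of `|z ± w|` and `|z ± iw|` is at least `(|z|^2 + |w|^2/4)^{1/2}`
(`sqrt_le_four_point`), a power sum of exponent `2`; averaging over rotations of `w` yields the
integral condition with exponent `1`. -/

noncomputable section

/-! ### Homogeneous functions: domination by compactness, power sums and differences -/

namespace PosHom

/-- A function which vanishes where `Z` does is, up to a small multiple of the `ℓ¹` norm,
bounded by a multiple of `Z`. -/
theorem exists_abs_le_add {ι : Type*} [Fintype ι] (Y Z : PosHom ι) (hZ : ∀ t, 0 ≤ Z.1 t)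
    (h0 : ∀ t, Z.1 t = 0 → Y.1 t = 0) {η : ℝ} (hη : 0 < η) :
    ∃ C : ℝ, 0 < C ∧ ∀ t, |Y.1 t| ≤ η * ∑ i, |t i| + C * Z.1 t := by
  have hYc : Continuous Y.1 := Y.2.1
  have hZc : Continuous Z.1 := Z.2.1
  -- On this compact part of the `ℓ¹` sphere `Z` has no zero, since its zeros are zeros of `Y`;
  -- hence `|Y| / Z` is bounded there. On the rest of the sphere the `η` term alone suffices.
  let K : Set (ι → ℝ) := {t | ∑ i, |t i| = 1} ∩ {t | η ≤ |Y.1 t|}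
  have hK : IsCompact K := by
    refine Metric.isCompact_of_isClosed_isBounded
      ((isClosed_eq (by fun_prop) continuous_const).inter
        (isClosed_le continuous_const hYc.abs)) ?_
    refine (Metric.isBounded_closedBall (x := (0 : ι → ℝ)) (r := 1)).subset fun t ht => ?_
    rw [mem_closedBall_zero_iff, pi_norm_le_iff_of_nonneg zero_le_one]
    intro i
    rw [← (ht.1 : ∑ i, |t i| = 1), Real.norm_eq_abs]
    exact Finset.single_le_sum (f := fun i => |t i|) (fun i _ => abs_nonneg _) (Finset.mem_univ i)
  have hpos : ∀ t ∈ K, 0 < Z.1 t := fun t ht => by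
    refine (hZ t).lt_of_ne fun h => ?_
    have h2 : η ≤ |Y.1 t| := ht.2
    rw [h0 t h.symm, abs_zero] at h2
    linarith
  obtain ⟨B, hB⟩ := hK.bddAbove_image (f := fun t => |Y.1 t| / Z.1 t)
    (hYc.abs.continuousOn.div hZc.continuousOn fun t ht => (hpos t ht).ne')
  refine ⟨max B 1, by positivity, fun t => ?_⟩
  have hC : 0 < max B 1 := by positivity
  have unit : ∀ t : ι → ℝ, ∑ i, |t i| = 1 → |Y.1 t| ≤ η + max B 1 * Z.1 t := by
    intro t ht
    by_cases hY : η ≤ |Y.1 t|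
    · have h1 : |Y.1 t| / Z.1 t ≤ max B 1 :=
        (hB ⟨t, ⟨ht, hY⟩, rfl⟩).trans (le_max_left _ _)
      rw [div_le_iff₀ (hpos t ⟨ht, hY⟩)] at h1
      linarith
    · have := mul_nonneg hC.le (hZ t)
      linarith
  set S := ∑ i, |t i| with hS
  have hS0 : 0 ≤ S := Finset.sum_nonneg fun i _ => abs_nonneg _
  rcases hS0.eq_or_lt with h | hSpos
  -- At the origin, homogeneity with factor `0` makes both functions vanish.
  · have ht : t = (0 : ℝ) • t := by
      funext i
      have := (Finset.sum_eq_zero_iff_of_nonneg (fun i _ => abs_nonneg (t i))).1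
        (hS.symm.trans h.symm) i (Finset.mem_univ i)
      simpa using this
    rw [ht, Y.2.2 0 le_rfl, Z.2.2 0 le_rfl, ← h]
    simp
  · have h1 := unit (S⁻¹ • t) (by
      simp only [Pi.smul_apply, smul_eq_mul, abs_mul, ← Finset.mul_sum,
        abs_of_pos (inv_pos.2 hSpos)]
      exact inv_mul_cancel₀ hSpos.ne')
    have ht : t = S • (S⁻¹ • t) := by simp [smul_smul, hSpos.ne']
    rw [ht, Y.2.2 S hS0, Z.2.2 S hS0, abs_mul, abs_of_pos hSpos]
    nlinarith

/-- The function `(s, t) ↦ (|s|^r + |t|^r)^{1/r}`, for every `r > 0`. -/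
def absPowerSum (r : ℝ) (hr : 0 < r) : PosHom (Fin 2) :=
  ⟨fun t => (|t 0| ^ r + |t 1| ^ r) ^ (1 / r), by
    refine ⟨?_, fun c hc t => ?_⟩
    · refine Continuous.rpow_const ?_ fun _ => Or.inr (by positivity)
      exact (((continuous_apply 0).abs).rpow_const fun _ => Or.inr hr.le).add
        (((continuous_apply 1).abs).rpow_const fun _ => Or.inr hr.le)
    · simp only [Pi.smul_apply, smul_eq_mul, abs_mul, abs_of_nonneg hc]
      rw [Real.mul_rpow hc (abs_nonneg _), Real.mul_rpow hc (abs_nonneg _), ← mul_add,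
        Real.mul_rpow (by positivity) (by positivity), ← Real.rpow_mul hc,
        mul_one_div_cancel hr.ne', Real.rpow_one]⟩

/-- The function `(N^r - |t₀|^r)^{1/r}`, for `N` above the modulus of the first coordinate. -/
def powerDiff (r : ℝ) (hr : 0 < r) (N : PosHom (Fin 2)) (hN : ∀ t, |t 0| ≤ N.1 t) :
    PosHom (Fin 2) :=
  ⟨fun t => (N.1 t ^ r - |t 0| ^ r) ^ (1 / r), by
    have hNc : Continuous N.1 := N.2.1
    refine ⟨?_, fun c hc t => ?_⟩
    · refine Continuous.rpow_const ?_ fun _ => Or.inr (by positivity)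
      exact (hNc.rpow_const fun _ => Or.inr hr.le).sub
        (((continuous_apply 0).abs).rpow_const fun _ => Or.inr hr.le)
    · have h0 : 0 ≤ N.1 t := (abs_nonneg _).trans (hN t)
      have h1 : 0 ≤ N.1 t ^ r - |t 0| ^ r :=
        sub_nonneg.2 (Real.rpow_le_rpow (abs_nonneg _) (hN t) hr.le)
      show (N.1 (c • t) ^ r - |(c • t) 0| ^ r) ^ (1 / r) = c * (N.1 t ^ r - |t 0| ^ r) ^ (1 / r)
      rw [N.2.2 c hc]
      simp only [Pi.smul_apply, smul_eq_mul, abs_mul, abs_of_nonneg hc]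
      rw [Real.mul_rpow hc (abs_nonneg _), Real.mul_rpow hc h0, ← mul_sub,
        Real.mul_rpow (by positivity) h1, ← Real.rpow_mul hc,
        mul_one_div_cancel hr.ne', Real.rpow_one]⟩

theorem abs_le_absPowerSum {r : ℝ} (hr : 0 < r) (t : Fin 2 → ℝ) :
    |t 0| ≤ (absPowerSum r hr).1 t := by
  have h : (|t 0| ^ r) ^ (1 / r) = |t 0| := by
    rw [← Real.rpow_mul (abs_nonneg _), mul_one_div_cancel hr.ne', Real.rpow_one]
  calc |t 0| = (|t 0| ^ r) ^ (1 / r) := h.symm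
    _ ≤ (|t 0| ^ r + |t 1| ^ r) ^ (1 / r) := by
      gcongr
      exact le_add_of_nonneg_right (by positivity)

theorem eq_zero_of_absPowerSum_eq {r : ℝ} (hr : 0 < r) (t : Fin 2 → ℝ)
    (h : (absPowerSum r hr).1 t = |t 0|) : t 1 = 0 := by
  have h1 : ((|t 0| ^ r + |t 1| ^ r) ^ (1 / r)) ^ r = |t 0| ^ r := congrArg (· ^ r) h
  rw [← Real.rpow_mul (by positivity), one_div_mul_cancel hr.ne', Real.rpow_one] at h1
  have h2 : |t 1| ^ r = 0 := by linarith
  exact abs_eq_zero.1 ((Real.rpow_eq_zero (abs_nonneg _) hr.ne').1 h2)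

end PosHom

/-! ### Upper monotonicity relative to a homogeneous function -/

section UpperMonotone

variable (E : Type*) [NormedAddCommGroup E] [NormedSpace ℝ E] [Lattice E]
  [HasSolidNorm E] [IsOrderedAddMonoid E] [IsOrderedModule ℝ E] [CompleteSpace E]

/-- For every `x` of norm one and every `ε > 0`, the infimum of `‖F(x, y)‖ - 1` over `‖y‖ ≥ ε` is
positive. -/
def UpperMonotoneFor (F : PosHom (Fin 2)) : Prop :=
  ∀ x : E, ‖x‖ = 1 → ∀ ε : ℝ, 0 < ε → ∃ δ : ℝ, 0 < δ ∧
    ∀ y : E, ε ≤ ‖y‖ → 1 + δ ≤ ‖krivine ![x, y] F‖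

variable {E}

theorem krivine_comp_proj_zero (x y : E) (F Z : PosHom (Fin 2)) :
    krivine ![x, krivine ![x, y] Z] F =
      krivine ![x, y] (PosHom.comp F ![PosHom.proj 0, Z]) := by
  rw [← krivine_comp₂, krivine_proj]
  rfl

/-- The hypothesis on `F` is applied to the pair `x`, `Z(x, y)` in place of `x`, `y`. This is
legitimate because `Z` vanishes only where the second coordinate does, so `Z(x, y)` cannot be small
in norm when `y` is not. -/
theorem UpperMonotoneFor.of_comp {F H Z : PosHom (Fin 2)} (hF : UpperMonotoneFor E F)
    (hZ : ∀ t, 0 ≤ Z.1 t) (h0 : ∀ t, Z.1 t = 0 → t 1 = 0)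
    (hle : ∀ t, |(PosHom.comp F ![PosHom.proj 0, Z]).1 t| ≤ H.1 t) : UpperMonotoneFor E H := by
  intro x hx ε hε
  -- With `‖x‖ = 1` the domination reads `‖y‖ ≤ η(1 + ‖y‖) + C‖Z(x,y)‖`. The bound `η ≤ 1/2` absorbs
  -- half of `‖y‖` and `η ≤ ε/4` leaves `ε/2 - ε/4 = ε/4` for `C‖Z(x,y)‖`.
  obtain ⟨C, hC, hCle⟩ := PosHom.exists_abs_le_add (PosHom.proj 1) Z hZ h0
    (η := min (1 / 2) (ε / 4)) (by positivity)
  obtain ⟨δ, hδ, hδ'⟩ := hF x hx (ε / (4 * C)) (by positivity)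
  refine ⟨δ, hδ, fun y hy => ?_⟩
  have hZy : ε / (4 * C) ≤ ‖krivine ![x, y] Z‖ := by
    set η := min (1 / 2) (ε / 4)
    have h1 : ‖krivine ![x, y] (PosHom.proj 1)‖ ≤ η * (‖x‖ + ‖y‖) + C * ‖krivine ![x, y] Z‖ := by
      have hη0 : 0 ≤ η := by positivity
      refine (norm_krivine_le ![x, y] (g := η • ((PosHom.proj 0 ⊔ -PosHom.proj 0)
        + (PosHom.proj 1 ⊔ -PosHom.proj 1)) + C • Z) fun t => ?_).trans ?_
      · have := hCle t
        rw [Fin.sum_univ_two] at this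
        exact this
      · rw [map_add, map_smul, map_smul, map_add, krivine_proj_sup_neg, krivine_proj_sup_neg]
        refine (norm_add_le _ _).trans ?_
        rw [norm_smul, norm_smul, Real.norm_of_nonneg hη0, Real.norm_of_nonneg hC.le]
        gcongr
        refine (norm_add_le _ _).trans ?_
        rw [norm_abs_eq_norm, norm_abs_eq_norm]
        rfl
    rw [krivine_proj] at h1
    replace h1 : ‖y‖ ≤ η * (‖x‖ + ‖y‖) + C * ‖krivine ![x, y] Z‖ := h1
    rw [hx] at h1
    have h2 : η ≤ 1 / 2 := min_le_left _ _
    have h3 : η ≤ ε / 4 := min_le_right _ _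
    rw [div_le_iff₀ (by positivity)]
    nlinarith [norm_nonneg y]
  refine (hδ' _ hZy).trans ?_
  rw [krivine_comp_proj_zero]
  exact norm_krivine_le _ hle

/-- The function `Z = (N^r - |t₀|^r)^{1/r}` turns `N` into the `r`-power sum of `t₀` and `Z`, and
its zeros are exactly the points where `N` equals `|t₀|`. -/
theorem UpperMonotoneFor.of_absPowerSum {r : ℝ} {hr : 0 < r}
    (h : UpperMonotoneFor E (PosHom.absPowerSum r hr)) {N : PosHom (Fin 2)}
    (hN : ∀ t, |t 0| ≤ N.1 t) (h0 : ∀ t, N.1 t = |t 0| → t 1 = 0) : UpperMonotoneFor E N := by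
  have hr' : 1 / r ≠ 0 := by positivity
  have hd : ∀ t : Fin 2 → ℝ, 0 ≤ N.1 t ^ r - |t 0| ^ r := fun t =>
    sub_nonneg.2 (Real.rpow_le_rpow (abs_nonneg _) (hN t) hr.le)
  have hN0 : ∀ t, 0 ≤ N.1 t := fun t => (abs_nonneg _).trans (hN t)
  refine h.of_comp (Z := PosHom.powerDiff r hr N hN) (fun t => Real.rpow_nonneg (hd t) _)
    (fun t ht => h0 t ?_) fun t => ?_
  · have h1 := (Real.rpow_eq_zero (hd t) hr').1 ht
    exact (Real.rpow_left_inj (hN0 t) (abs_nonneg _) hr.ne').1 (sub_eq_zero.1 h1)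
  · show |(|t 0| ^ r + |(N.1 t ^ r - |t 0| ^ r) ^ (1 / r)| ^ r) ^ (1 / r)| ≤ N.1 t
    rw [abs_of_nonneg (Real.rpow_nonneg (hd t) _), ← Real.rpow_mul (hd t),
      one_div_mul_cancel hr.ne', Real.rpow_one, add_sub_cancel, ← Real.rpow_mul (hN0 t),
      mul_one_div_cancel hr.ne', Real.rpow_one, abs_of_nonneg (hN0 t)]

/-- All positive exponents are interchangeable. Exponents below one are included because the
convexification produces the exponent `1/p`. -/
theorem UpperMonotoneFor.absPowerSum {r : ℝ} {hr : 0 < r}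
    (h : UpperMonotoneFor E (PosHom.absPowerSum r hr)) {q : ℝ} (hq : 0 < q) :
    UpperMonotoneFor E (PosHom.absPowerSum q hq) :=
  h.of_absPowerSum (PosHom.abs_le_absPowerSum hq) (PosHom.eq_zero_of_absPowerSum_eq hq)

variable (E) in
theorem upperLocallyUniformlyMonotone_iff {r : ℝ} (hr : 0 < r) :
    UpperLocallyUniformlyMonotone E ↔ UpperMonotoneFor E (PosHom.absPowerSum r hr) := by
  constructor
  · rintro ⟨p, hp, h⟩
    -- `powerSum p` and `absPowerSum p` have the same underlying function, so `h` has the required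
    -- type by unfolding.
    exact UpperMonotoneFor.absPowerSum (r := p) (hr := by linarith) h hr
  · intro h
    exact ⟨1, le_rfl, h.absPowerSum one_pos⟩

theorem krivine_abs_abs (x y : E) (F : PosHom (Fin 2)) :
    krivine ![|x|, |y|] F = krivine ![x, y] (PosHom.comp F
      ![PosHom.proj 0 ⊔ -PosHom.proj 0, PosHom.proj 1 ⊔ -PosHom.proj 1]) := by
  rw [← krivine_comp₂, krivine_proj_sup_neg, krivine_proj_sup_neg]
  rfl

end UpperMonotone

/-! ### Midpoint convexity of the convexification -/

section Midpoint

variable {E : Type*} [NormedAddCommGroup E] [NormedSpace ℝ E] [Lattice E]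
  [HasSolidNorm E] [IsOrderedAddMonoid E] [IsOrderedModule ℝ E] [CompleteSpace E]
  {p : ℝ}

/-- The function `(s, t) ↦ (s^{1/p} - t^{1/p})^p`, powers being sign-preserving. -/
def convexificationSub (p : ℝ) (hp : 1 ≤ p) : PosHom (Fin 2) :=
  PosHom.comp (convexificationAdd p hp) ![PosHom.proj 0, -PosHom.proj 1]

theorem abs_convexificationAdd (hp : 1 ≤ p) (t : Fin 2 → ℝ) :
    |(convexificationAdd p hp).1 t| = |signPow (1 / p) (t 0) + signPow (1 / p) (t 1)| ^ p :=
  abs_signPow (by linarith) _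

theorem abs_convexificationSub (hp : 1 ≤ p) (t : Fin 2 → ℝ) :
    |(convexificationSub p hp).1 t| = |signPow (1 / p) (t 0) - signPow (1 / p) (t 1)| ^ p := by
  rw [sub_eq_add_neg, ← signPow_neg]
  exact abs_signPow (by linarith) _

theorem Convexification.norm_add_eq {hp : 1 ≤ p} (x y : Convexification E p hp) :
    ‖x + y‖ = ‖krivine ![x.val, y.val] (convexificationAdd p hp)‖ ^ (1 / p) := rfl

theorem Convexification.norm_sub_eq {hp : 1 ≤ p} (x y : Convexification E p hp) :
    ‖x - y‖ = ‖krivine ![x.val, y.val] (convexificationSub p hp)‖ ^ (1 / p) := by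
  rw [sub_eq_add_neg, norm_add_eq, val_neg, convexificationSub, ← krivine_comp₂, map_neg,
    krivine_proj, krivine_proj]
  rfl

/-- The triangle inequality for `1/p`-th powers bounds both `|x ⊕ y|` and `|x ⊖ y|` by the power sum
of exponent `1/p`, so whichever norm attains the maximum gives the estimate. -/
theorem UpperMonotoneFor.of_midpoint {hp : 1 ≤ p}
    (h : MidpointLocallyUniformlyConvex (Convexification E p hp)) (hr : 0 < 1 / p) :
    UpperMonotoneFor E (PosHom.absPowerSum (1 / p) hr) := by
  have hp0 : 0 < p := by linarith
  intro x hx ε hε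
  obtain ⟨δ, hδ, H⟩ := h ⟨|x|⟩ (by
    rw [Convexification.norm_def, norm_abs_eq_norm, hx, Real.one_rpow]) (ε ^ (1 / p)) (by positivity)
  refine ⟨δ, hδ, fun y hy => ?_⟩
  have h1 := H ⟨|y|⟩ (by
    rw [Convexification.norm_def, norm_abs_eq_norm]
    exact Real.rpow_le_rpow hε.le hy hr.le)
  rw [Convexification.norm_add_eq, Convexification.norm_sub_eq, krivine_abs_abs,
    krivine_abs_abs] at h1
  set A := ‖krivine ![x, y] (PosHom.absPowerSum (1 / p) hr)‖
  have habs : ∀ s : ℝ, |signPow (1 / p) (|s|)| = |s| ^ (1 / p) := fun s => by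
    rw [abs_signPow hr, abs_abs]
  have hle : ∀ F : PosHom (Fin 2), (∀ t, |F.1 t| ≤
      (|signPow (1 / p) (t 0)| + |signPow (1 / p) (t 1)|) ^ p) →
      ‖krivine ![x, y] (PosHom.comp F ![PosHom.proj 0 ⊔ -PosHom.proj 0,
        PosHom.proj 1 ⊔ -PosHom.proj 1])‖ ^ (1 / p) ≤ A ^ (1 / p) := by
    intro F hF
    refine Real.rpow_le_rpow (norm_nonneg _) (norm_krivine_le _ fun t => ?_) hr.le
    have h2 : |F.1 ![|t 0|, |t 1|]| ≤ (|t 0| ^ (1 / p) + |t 1| ^ (1 / p)) ^ (1 / (1 / p)) := by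
      have := hF ![|t 0|, |t 1|]
      rw [one_div_one_div]
      simpa only [Matrix.cons_val_zero, Matrix.cons_val_one, habs] using this
    convert h2 using 2
    · refine congrArg F.1 (funext fun j => ?_)
      fin_cases j <;> rfl
    · rfl
  have h2 : 1 + δ ≤ A ^ (1 / p) := h1.trans (max_le
    (hle _ fun t => by
      rw [abs_convexificationAdd]
      exact Real.rpow_le_rpow (abs_nonneg _) (abs_add_le _ _) hp0.le)
    (hle _ fun t => by
      rw [abs_convexificationSub]
      exact Real.rpow_le_rpow (abs_nonneg _) (abs_sub _ _) hp0.le))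
  -- The norm of the convexification is a `1/p`-th power; undoing it costs nothing since `1 + δ ≥ 1`
  -- and `p ≥ 1`, so the same `δ` serves.
  calc 1 + δ ≤ (1 + δ) ^ p := Real.self_le_rpow_of_one_le (by linarith) hp
    _ ≤ (A ^ (1 / p)) ^ p := Real.rpow_le_rpow (by positivity) h2 hp0.le
    _ = A := by rw [← Real.rpow_mul (norm_nonneg _), one_div_mul_cancel hp0.ne', Real.rpow_one]

/-- Since `a` is the midpoint of `a + b` and `a - b`, `|a|` is at most the mean of their moduli;
then `u ↦ u^p` is increasing and convex on `[0, ∞)`. -/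
theorem abs_rpow_le_midpoint (hp : 1 ≤ p) (a b : ℝ) :
    |a| ^ p ≤ (|a + b| ^ p + |a - b| ^ p) / 2 := by
  have h1 : |a| ≤ 1 / 2 * |a + b| + 1 / 2 * |a - b| := by
    have := abs_add_le (a + b) (a - b)
    rw [add_add_sub_cancel, ← two_mul, abs_mul, abs_two] at this
    linarith
  have h2 := (convexOn_rpow hp).2 (Set.mem_Ici.2 (abs_nonneg (a + b)))
    (Set.mem_Ici.2 (abs_nonneg (a - b))) (by norm_num : (0 : ℝ) ≤ 1 / 2)
    (by norm_num : (0 : ℝ) ≤ 1 / 2) (by norm_num)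
  simp only [smul_eq_mul] at h2
  have h3 := Real.rpow_le_rpow (abs_nonneg a) h1 (by linarith : 0 ≤ p)
  linarith

/-- Strict convexity forces `|a + b| = |a - b|`, hence `a = 0` or `b = 0`; in the first case the
equality reads `|b|^p = 0`. -/
theorem eq_zero_of_midpoint_eq (hp : 1 < p) {a b : ℝ}
    (h : (|a + b| ^ p + |a - b| ^ p) / 2 = |a| ^ p) : b = 0 := by
  have hp0 : p ≠ 0 := by linarith
  by_cases huv : |a + b| = |a - b|
  · rcases abs_eq_abs.1 huv with h1 | h1
    · linarith
    · obtain rfl : a = 0 := by linarith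
      simp only [zero_add, zero_sub, abs_neg, abs_zero, Real.zero_rpow hp0] at h
      have : |b| ^ p = 0 := by linarith
      exact abs_eq_zero.1 ((Real.rpow_eq_zero (abs_nonneg _) hp0).1 this)
  · have h1 : |a| ≤ 1 / 2 * |a + b| + 1 / 2 * |a - b| := by
      have := abs_add_le (a + b) (a - b)
      rw [add_add_sub_cancel, ← two_mul, abs_mul, abs_two] at this
      linarith
    have h2 := (strictConvexOn_rpow hp).2 (Set.mem_Ici.2 (abs_nonneg (a + b)))
      (Set.mem_Ici.2 (abs_nonneg (a - b))) huv (by norm_num : (0 : ℝ) < 1 / 2)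
      (by norm_num : (0 : ℝ) < 1 / 2) (by norm_num)
    simp only [smul_eq_mul] at h2
    have h3 := Real.rpow_le_rpow (abs_nonneg a) h1 (by linarith : 0 ≤ p)
    linarith

/-- The function `(s, t) ↦ (|s ⊕ t| + |s ⊖ t|) / 2` in the operations of the convexification. -/
def convexificationMean (p : ℝ) (hp : 1 ≤ p) : PosHom (Fin 2) :=
  (1 / 2 : ℝ) • ((convexificationAdd p hp ⊔ -convexificationAdd p hp) +
    (convexificationSub p hp ⊔ -convexificationSub p hp))

theorem convexificationMean_apply (hp : 1 ≤ p) (t : Fin 2 → ℝ) :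
    (convexificationMean p hp).1 t =
      (|signPow (1 / p) (t 0) + signPow (1 / p) (t 1)| ^ p +
        |signPow (1 / p) (t 0) - signPow (1 / p) (t 1)| ^ p) / 2 := by
  rw [← abs_convexificationAdd hp, ← abs_convexificationSub hp, div_eq_inv_mul, ← one_div]
  rfl

/-- The two scalar midpoint lemmas, at `a = s^{1/p}` and `b = t^{1/p}` with signed powers, are
precisely the conditions on `N` in `UpperMonotoneFor.of_absPowerSum`. -/
theorem UpperMonotoneFor.mean (hp : 1 < p) {r : ℝ} {hr : 0 < r}
    (h : UpperMonotoneFor E (PosHom.absPowerSum r hr)) :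
    UpperMonotoneFor E (convexificationMean p hp.le) := by
  have hp0 : 0 < p := by linarith
  have hq : 0 < 1 / p := by positivity
  have habs : ∀ s : ℝ, |signPow (1 / p) s| ^ p = |s| := fun s => by
    rw [abs_signPow hq, ← Real.rpow_mul (abs_nonneg _), one_div_mul_cancel hp0.ne', Real.rpow_one]
  refine h.of_absPowerSum (fun t => ?_) fun t ht => ?_
  · rw [convexificationMean_apply, ← habs (t 0)]
    exact abs_rpow_le_midpoint hp.le _ _
  · rw [convexificationMean_apply, ← habs (t 0)] at ht
    rw [← Convexification.signPow_p hp.le (t 1), eq_zero_of_midpoint_eq hp ht, signPow_zero]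

theorem UpperMonotoneFor.midpoint {hp : 1 ≤ p}
    (h : UpperMonotoneFor E (convexificationMean p hp)) :
    MidpointLocallyUniformlyConvex (Convexification E p hp) := by
  have hp0 : 0 < p := by linarith
  have hq : 0 < 1 / p := by positivity
  have hval : ∀ z : Convexification E p hp, ‖z.val‖ = ‖z‖ ^ p := fun z => by
    rw [Convexification.norm_def, ← Real.rpow_mul (norm_nonneg _), one_div_mul_cancel hp0.ne',
      Real.rpow_one]
  intro x hx ε hε
  obtain ⟨δ, hδ, H⟩ := h x.val (by rw [hval, hx, Real.one_rpow]) (ε ^ p) (by positivity)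
  -- The gap `1 + δ` is found for norms in `E`; the norm of the convexification is the `1/p`-th
  -- power of these. As the mean of `A` and `B` is at least `1 + δ`, so is the larger one.
  refine ⟨(1 + δ) ^ (1 / p) - 1, sub_pos.2 (Real.one_lt_rpow (by linarith) hq), fun y hy => ?_⟩
  have h1 := H y.val (by rw [hval]; exact Real.rpow_le_rpow hε.le hy hp0.le)
  set A := ‖krivine ![x.val, y.val] (convexificationAdd p hp)‖
  set B := ‖krivine ![x.val, y.val] (convexificationSub p hp)‖
  have h2 : ‖krivine ![x.val, y.val] (convexificationMean p hp)‖ ≤ 1 / 2 * (A + B) := by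
    rw [convexificationMean, map_smul, map_add, krivine_sup, krivine_sup, map_neg, map_neg,
      norm_smul, Real.norm_of_nonneg (by norm_num)]
    gcongr
    refine (norm_add_le _ _).trans (add_le_add ?_ ?_)
    · exact (norm_abs_eq_norm _).le
    · exact (norm_abs_eq_norm _).le
  rw [add_sub_cancel, Convexification.norm_add_eq, Convexification.norm_sub_eq, le_max_iff]
  rcases le_total A B with hAB | hAB
  · exact Or.inr (Real.rpow_le_rpow (by linarith) (by linarith) hq.le)
  · exact Or.inl (Real.rpow_le_rpow (by linarith) (by linarith) hq.le)

end Midpoint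

/-! ### Complex convexity of the complexification -/

namespace LatticeComplexification

variable {E : Type*} [NormedAddCommGroup E] [NormedSpace ℝ E] [Lattice E]
  [HasSolidNorm E] [IsOrderedAddMonoid E] [IsOrderedModule ℝ E] [CompleteSpace E]

theorem norm_mk_krivine {ι : Type*} [Fintype ι] (X : ι → E) (a b : PosHom ι) :
    ‖(⟨krivine X a, krivine X b⟩ : LatticeComplexification E)‖ =
      ‖krivine X (PosHom.comp euclideanModulus ![a, b])‖ := by
  rw [← krivine_comp₂]
  rfl

theorem norm_mk_zero (x : E) : ‖(⟨x, 0⟩ : LatticeComplexification E)‖ = ‖x‖ := by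
  have h := norm_mk_krivine (fun _ : Fin 1 => x) (PosHom.proj 0) 0
  rw [krivine_proj, map_zero] at h
  rw [h, ← norm_abs_eq_norm x, ← krivine_proj_sup_neg (fun _ : Fin 1 => x) 0]
  congr 2
  apply Subtype.ext
  funext t
  show √(t 0 ^ 2 + 0 ^ 2) = |t 0|
  rw [zero_pow two_ne_zero, add_zero, Real.sqrt_sq_eq_abs]

/-- This is the scalar triangle inequality `|s + ct| ≤ |s| + |t|` for real `s`, `t` and unimodular
`c`, carried over by the calculus. -/
theorem norm_mk_add_smul_le (x y : E) {c : ℂ} (hc : ‖c‖ = 1) :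
    ‖(⟨x, 0⟩ : LatticeComplexification E) + c • ⟨y, 0⟩‖ ≤
      ‖krivine ![x, y] (PosHom.absPowerSum 1 one_pos)‖ := by
  have h := norm_mk_krivine ![x, y] (PosHom.proj 0 + c.re • PosHom.proj 1) (c.im • PosHom.proj 1)
  have e : (⟨x, 0⟩ : LatticeComplexification E) + c • ⟨y, 0⟩ =
      ⟨krivine ![x, y] (PosHom.proj 0 + c.re • PosHom.proj 1),
        krivine ![x, y] (c.im • PosHom.proj 1)⟩ := by
    rw [map_add, map_smul, map_smul, krivine_proj, krivine_proj]
    ext <;> simp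
  rw [e, h]
  refine norm_krivine_le _ fun t => ?_
  show |√((t 0 + c.re * t 1) ^ 2 + (c.im * t 1) ^ 2)| ≤
    (|t 0| ^ (1 : ℝ) + |t 1| ^ (1 : ℝ)) ^ (1 / (1 : ℝ))
  rw [abs_of_nonneg (Real.sqrt_nonneg _), div_one, Real.rpow_one, Real.rpow_one, Real.rpow_one]
  have h1 := norm_add_le (t 0 : ℂ) (c * t 1)
  rw [norm_mul, hc, one_mul, Complex.norm_real, Complex.norm_real, Real.norm_eq_abs,
    Real.norm_eq_abs] at h1
  convert h1 using 1
  rw [Complex.norm_def, Complex.normSq_apply]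
  congr 1
  simp [← sq]

/-- Tested on real elements, the integrand is at most `‖|x| + |y|‖^p` for every angle, so the
`p`-mean is at most `‖|x| + |y|‖` whatever the exponent `p` attached to `x`. -/
theorem upperMonotoneFor_of_complexConvex
    (h : LocallyUniformlyComplexConvex (LatticeComplexification E)) :
    UpperMonotoneFor E (PosHom.absPowerSum 1 one_pos) := by
  intro x hx ε hε
  obtain ⟨p, hp, H⟩ := h ⟨x, 0⟩ (by rw [norm_mk_zero, hx])
  obtain ⟨δ, hδ, H⟩ := H ε hε
  refine ⟨δ, hδ, fun y hy => (H ⟨y, 0⟩ (by rwa [norm_mk_zero])).trans ?_⟩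
  set A := ‖krivine ![x, y] (PosHom.absPowerSum 1 one_pos)‖
  have hA0 : 0 ≤ A := norm_nonneg _
  set I := ∫ θ in (0 : ℝ)..(2 * Real.pi), ‖(⟨x, 0⟩ : LatticeComplexification E) +
    Complex.exp (θ * Complex.I) • (⟨y, 0⟩ : LatticeComplexification E)‖ ^ p
  have hI0 : 0 ≤ I := intervalIntegral.integral_nonneg (by positivity) fun θ _ => by positivity
  have h1 : I ≤ A ^ p * (2 * Real.pi) := by
    have := intervalIntegral.norm_integral_le_of_norm_le_const (a := 0) (b := 2 * Real.pi)
      (C := A ^ p) (f := fun θ : ℝ => ‖(⟨x, 0⟩ : LatticeComplexification E) +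
        Complex.exp (θ * Complex.I) • (⟨y, 0⟩ : LatticeComplexification E)‖ ^ p) fun θ _ => by
        rw [Real.norm_of_nonneg (by positivity)]
        exact Real.rpow_le_rpow (norm_nonneg _)
          (norm_mk_add_smul_le x y (Complex.norm_exp_ofReal_mul_I θ)) hp.le
    rw [sub_zero, abs_of_pos Real.two_pi_pos] at this
    exact (le_abs_self _).trans this
  calc (1 / (2 * Real.pi) * I) ^ (1 / p) ≤ (A ^ p) ^ (1 / p) := by
        refine Real.rpow_le_rpow (by positivity) ?_ (by positivity)
        rw [one_div_mul_eq_div, div_le_iff₀ Real.two_pi_pos]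
        exact h1
    _ = A := by rw [← Real.rpow_mul hA0, mul_one_div_cancel hp.ne', Real.rpow_one]

/-- Square the sum of the four moduli. The squares contribute `4|z|^2 + 4|w|^2` by the parallelogram
law, the products within the two pairs at least `4|z|^2`, and those across the pairs at least
`8|z|^2`. The total `16|z|^2 + 4|w|^2`, divided by `16`, explains the factor `1/2` on `|w|`. -/
theorem sqrt_le_four_point (z w : ℂ) :
    √(‖z‖ ^ 2 + (1 / 2 * ‖w‖) ^ 2) ≤ 1 / 4 * ((‖z + w‖ + ‖z - w‖) +
      (‖z + Complex.I * w‖ + ‖z - Complex.I * w‖)) := by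
  have par : ∀ v : ℂ, ‖z + v‖ ^ 2 + ‖z - v‖ ^ 2 = 2 * (‖z‖ ^ 2 + ‖v‖ ^ 2) := fun v => by
    have := parallelogram_law_with_norm ℝ z v
    linarith
  have tri : ∀ v : ℂ, 2 * ‖z‖ ≤ ‖z + v‖ + ‖z - v‖ := fun v => by
    have := norm_add_le (z + v) (z - v)
    rwa [add_add_sub_cancel, ← two_mul, norm_mul, Complex.norm_two] at this
  have h1 := par w
  have h2 := par (Complex.I * w)
  rw [norm_mul, Complex.norm_I, one_mul] at h2
  have h3 : 2 * ‖z‖ ^ 2 ≤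
      ‖z + w‖ * ‖z - w‖ + ‖z + Complex.I * w‖ * ‖z - Complex.I * w‖ := by
    -- The terms `-w^2` and `+w^2` of the two products cancel; this is why the directions `w` and
    -- `iw` are used together.
    have e1 : (z + w) * (z - w) + (z + Complex.I * w) * (z - Complex.I * w) = 2 * z ^ 2 := by
      linear_combination -w ^ 2 * Complex.I_sq
    have := norm_add_le ((z + w) * (z - w)) ((z + Complex.I * w) * (z - Complex.I * w))
    rwa [e1, norm_mul, norm_mul, norm_mul, norm_pow, Complex.norm_two] at this
  have h4 : 2 * ‖z‖ * (2 * ‖z‖) ≤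
      (‖z + w‖ + ‖z - w‖) * (‖z + Complex.I * w‖ + ‖z - Complex.I * w‖) :=
    mul_le_mul (tri _) (tri _) (by positivity) (by positivity)
  refine Real.sqrt_le_iff.2 ⟨by positivity, ?_⟩
  nlinarith

/-- The modulus of an element of the complexification. -/
def modulus (z : LatticeComplexification E) : E := krivine ![z.re, z.im] euclideanModulus

theorem norm_modulus (z : LatticeComplexification E) : ‖modulus z‖ = ‖z‖ := rfl

/-- All the elements involved are values of the calculus at the four real and imaginary parts, which
reduces the inequality to `sqrt_le_four_point` at each point of `ℝ⁴`. -/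
theorem norm_krivine_modulus_le (z w : LatticeComplexification E) :
    ‖krivine ![modulus z, (1 / 2 : ℝ) • modulus w] (PosHom.absPowerSum 2 two_pos)‖ ≤
      1 / 4 * ((‖z + w‖ + ‖z - w‖) + (‖z + Complex.I • w‖ + ‖z - Complex.I • w‖)) := by
  let X : Fin 4 → E := ![z.re, z.im, w.re, w.im]
  let P : Fin 4 → PosHom (Fin 4) := PosHom.proj
  let m : PosHom (Fin 4) → PosHom (Fin 4) → PosHom (Fin 4) := fun a b =>
    PosHom.comp euclideanModulus ![a, b]
  have hP : ∀ i, krivine X (P i) = X i := krivine_proj X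
  have m1 : modulus z = krivine X (m (P 0) (P 1)) := by
    rw [← krivine_comp₂, hP, hP]
    rfl
  have m2 : modulus w = krivine X (m (P 2) (P 3)) := by
    rw [← krivine_comp₂, hP, hP]
    rfl
  have n1 : ‖z + w‖ = ‖krivine X (m (P 0 + P 2) (P 1 + P 3))‖ := by
    rw [← norm_mk_krivine, map_add, map_add, hP, hP, hP, hP]
    rfl
  have n2 : ‖z - w‖ = ‖krivine X (m (P 0 - P 2) (P 1 - P 3))‖ := by
    rw [← norm_mk_krivine, map_sub, map_sub, hP, hP, hP, hP]
    congr 1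
    ext <;> simp [sub_eq_add_neg, X]
  have n3 : ‖z + Complex.I • w‖ = ‖krivine X (m (P 0 - P 3) (P 1 + P 2))‖ := by
    rw [← norm_mk_krivine, map_sub, map_add, hP, hP, hP, hP]
    congr 1
    ext <;> simp [sub_eq_add_neg, X]
  have n4 : ‖z - Complex.I • w‖ = ‖krivine X (m (P 0 + P 3) (P 1 - P 2))‖ := by
    rw [← norm_mk_krivine, map_sub, map_add, hP, hP, hP, hP]
    congr 1
    ext <;> simp [sub_eq_add_neg, X]
  rw [n1, n2, n3, n4, m1, m2, ← map_smul, krivine_comp₂]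
  refine (norm_krivine_le X (g := (1 / 4 : ℝ) • ((m (P 0 + P 2) (P 1 + P 3) +
    m (P 0 - P 2) (P 1 - P 3)) + (m (P 0 - P 3) (P 1 + P 2) + m (P 0 + P 3) (P 1 - P 2))))
    fun t => ?_).trans ?_
  · have hn : ∀ a b : ℝ, √(a ^ 2 + b ^ 2) = ‖(⟨a, b⟩ : ℂ)‖ := fun a b => by
      rw [Complex.norm_def, Complex.normSq_apply, ← sq, ← sq]
    show |(|√(t 0 ^ 2 + t 1 ^ 2)| ^ (2 : ℝ) + |1 / 2 * √(t 2 ^ 2 + t 3 ^ 2)| ^ (2 : ℝ)) ^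
      (1 / (2 : ℝ))| ≤ 1 / 4 * ((√((t 0 + t 2) ^ 2 + (t 1 + t 3) ^ 2) +
        √((t 0 - t 2) ^ 2 + (t 1 - t 3) ^ 2)) + (√((t 0 - t 3) ^ 2 + (t 1 + t 2) ^ 2) +
        √((t 0 + t 3) ^ 2 + (t 1 - t 2) ^ 2)))
    rw [abs_of_nonneg (by positivity), ← Real.sqrt_eq_rpow, Real.rpow_two, Real.rpow_two, sq_abs,
      sq_abs]
    have h := sqrt_le_four_point ⟨t 0, t 1⟩ ⟨t 2, t 3⟩
    have e1 : (⟨t 0, t 1⟩ : ℂ) + ⟨t 2, t 3⟩ = ⟨t 0 + t 2, t 1 + t 3⟩ := rfl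
    have e2 : (⟨t 0, t 1⟩ : ℂ) - ⟨t 2, t 3⟩ = ⟨t 0 - t 2, t 1 - t 3⟩ := rfl
    have e3 : (⟨t 0, t 1⟩ : ℂ) + Complex.I * ⟨t 2, t 3⟩ = ⟨t 0 - t 3, t 1 + t 2⟩ := by
      apply Complex.ext <;> simp [sub_eq_add_neg]
    have e4 : (⟨t 0, t 1⟩ : ℂ) - Complex.I * ⟨t 2, t 3⟩ = ⟨t 0 + t 3, t 1 - t 2⟩ := by
      apply Complex.ext <;> simp
    rw [e1, e2, e3, e4] at h
    simpa only [hn] using h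
  · rw [map_smul, map_add, map_add, map_add, norm_smul, Real.norm_of_nonneg (by norm_num)]
    gcongr
    exact (norm_add_le _ _).trans (add_le_add (norm_add_le _ _) (norm_add_le _ _))

/-- The four-point inequality for `e^{iθ}w` bounds below the mean of the integrand over four angles
a quarter turn apart. By periodicity each of the four has the same integral over the circle, so
integrating in `θ` gives the bound for the circular mean. -/
theorem complexConvex_of_upperMonotoneFor
    (h : UpperMonotoneFor E (PosHom.absPowerSum 2 two_pos)) :
    LocallyUniformlyComplexConvex (LatticeComplexification E) := by
  intro z hz
  refine ⟨1, one_pos, fun ε hε => ?_⟩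
  -- The element tested is half the modulus of `e^{iθ}w`, whose norm is `‖w‖/2 ≥ ε/2` for every `θ`;
  -- hence `δ` does not depend on the angle.
  obtain ⟨δ, hδ, H⟩ := h (modulus z) (by rw [norm_modulus, hz]) (ε / 2) (by positivity)
  refine ⟨δ, hδ, fun w hw => ?_⟩
  simp only [Real.rpow_one, div_one]
  let e : ℝ → ℂ := fun θ => Complex.exp (θ * Complex.I)
  let f : ℝ → ℝ := fun θ => ‖z + e θ • w‖
  show 1 + δ ≤ 1 / (2 * Real.pi) * ∫ θ in (0 : ℝ)..(2 * Real.pi), f θ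
  have hf : Continuous f := by fun_prop
  have hfe : ∀ θ, f θ = ‖z + e θ • w‖ := fun _ => rfl
  have hπ : ∀ θ, e (θ + Real.pi) = -e θ := fun θ => by
    simp only [e]
    push_cast
    rw [add_mul, Complex.exp_add, Complex.exp_pi_mul_I, mul_neg_one]
  have hπ2 : ∀ θ, e (θ + Real.pi / 2) = Complex.I * e θ := fun θ => by
    simp only [e]
    push_cast
    rw [add_mul, Complex.exp_add, Complex.exp_pi_div_two_mul_I, mul_comm]
  have hper : Function.Periodic f (2 * Real.pi) := fun θ => by
    rw [hfe, hfe, two_mul, ← add_assoc, hπ, hπ, neg_neg]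
  have hshift : ∀ c : ℝ, ∫ θ in (0 : ℝ)..(2 * Real.pi), f (θ + c) =
      ∫ θ in (0 : ℝ)..(2 * Real.pi), f θ := fun c => by
    rw [intervalIntegral.integral_comp_add_right, zero_add, add_comm (2 * Real.pi) c,
      hper.intervalIntegral_add_eq c 0, zero_add]
  have key : ∀ θ, 1 + δ ≤ 1 / 4 * ((f θ + f (θ + Real.pi)) +
      (f (θ + Real.pi / 2) + f (θ + Real.pi / 2 + Real.pi))) := fun θ => by
    have he : ‖e θ • w‖ = ‖w‖ := by
      rw [norm_smul, Complex.norm_exp_ofReal_mul_I, one_mul]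
    have h1 := (H ((1 / 2 : ℝ) • modulus (e θ • w)) (by
      rw [norm_smul, norm_modulus, he, Real.norm_of_nonneg (by norm_num)]
      linarith)).trans (norm_krivine_modulus_le z (e θ • w))
    rwa [hfe, hfe, hfe, hfe, hπ, hπ, hπ2, neg_smul, neg_smul, mul_smul, ← sub_eq_add_neg,
      ← sub_eq_add_neg]
  have hi : ∀ c : ℝ, IntervalIntegrable (fun θ => f (θ + c)) MeasureTheory.volume 0
      (2 * Real.pi) := fun c => (hf.comp (continuous_add_const c)).intervalIntegrable _ _
  have hle := intervalIntegral.integral_mono_on (f := fun _ : ℝ => 1 + δ) (a := 0)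
    (b := 2 * Real.pi) (μ := MeasureTheory.volume) (by positivity)
    intervalIntegrable_const
    ((((hf.intervalIntegrable _ _).add (hi Real.pi)).add ((hi (Real.pi / 2)).add
      (hi (Real.pi / 2 + Real.pi)))).const_mul (1 / 4)) fun θ _ => by
        simpa only [add_assoc] using key θ
  rw [intervalIntegral.integral_const_mul, intervalIntegral.integral_add
    ((hf.intervalIntegrable _ _).add (hi _)) ((hi _).add (hi _)),
    intervalIntegral.integral_add (hf.intervalIntegrable _ _) (hi _),
    intervalIntegral.integral_add (hi _) (hi _), hshift, hshift, hshift,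
    intervalIntegral.integral_const, sub_zero, smul_eq_mul] at hle
  rw [one_div_mul_eq_div, le_div_iff₀ Real.two_pi_pos]
  linarith

end LatticeComplexification

end

/-! ### The equivalences -/

theorem mainTheorem4 {E : Type u} [NormedAddCommGroup E] [NormedSpace ℝ E] [Lattice E]
    [HasSolidNorm E] [IsOrderedAddMonoid E] [IsOrderedModule ℝ E] [CompleteSpace E]
    (hE : OrderContinuousNorm E ∨ IsKotheFunctionSpace.{u, v} E) :
    List.TFAE [
      UpperLocallyUniformlyMonotone E,
      LocallyUniformlyComplexConvex (LatticeComplexification E),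
      ∀ (p : ℝ) (hp : 1 < p), MidpointLocallyUniformlyConvex (Convexification E p hp.le),
      ∃ (p : ℝ) (hp : 1 < p), MidpointLocallyUniformlyConvex (Convexification E p hp.le)] := by
  -- The exponent in the first condition is normalised to `1`; each implication below then converts
  -- it to the exponent it needs.
  rw [upperLocallyUniformlyMonotone_iff E one_pos]
  tfae_have 1 → 2 := fun h =>
    LatticeComplexification.complexConvex_of_upperMonotoneFor (h.absPowerSum two_pos)
  tfae_have 2 → 1 := LatticeComplexification.upperMonotoneFor_of_complexConvex
  tfae_have 1 → 3 := fun h p hp => (h.mean hp).midpoint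
  tfae_have 3 → 4 := fun h => ⟨2, one_lt_two, h 2 one_lt_two⟩
  tfae_have 4 → 1 := fun ⟨p, hp, h⟩ =>
    (UpperMonotoneFor.of_midpoint h (by positivity)).absPowerSum one_pos
  tfae_finish
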